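/- Let $(\Omega,\mathcal F,P)$ be a probability space with a filtration $(\mathcal F_n)_{n\in\mathbb N}$ such that $\mathcal F=\mathcal F_\infty:=\sigma(\mathcal F_n,\ n\in\mathbb N)$. A two-player zero-sum stopping game is an adapted process $X=(X_n)_{n\in\mathbb N\cup\{\infty\}}$ of vectors $X_n=(X_n^{j,C})$ of real numbers, with $j\in\{1,2\}$ and $\emptyset\ne C\subseteq\{1,2\}$, such that $\mathbf E_P\bigl[\sup_n\|X_n\|\bigr]<\infty$ and $X^{1,C}+X^{2,C}=0$ for every $C$. Let $\lambda$ be the Lebesgue measure on $I=[0,1]$. We consider three classes of random stopping times $\eta$, each represented by a random time $\widetilde N_\eta(r,\omega)\in\mathbb N\cup\{\infty\}$, where $r$ is an auxiliary random draw and $\min\emptyset=\infty$: 1. Randomized: a nonnegative adapted real process $\rho=(\rho_n)_{n\in\mathbb N\cup\{\infty\}}$ with $\sum_{n\in\mathbb N\cup\{\infty\}}\rho_n(\omega)=1$ for every $\omega$; here $r\in I$ has law $\lambda$ and $\widetilde N_\rho(r,\omega)=\min\{n\in\mathbb N:\sum_{k\le n}\rho_k(\omega)\ge r\}$. 2. Behavior: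 an adapted $[0,1]$-valued process $\beta=(\beta_n)_{n\in\mathbb N}$; here $r=(r_n)_{n\in\mathbb N}\in I^{\mathbb N}$ has law $\lambda^{\mathbb N}$ and $\widetilde N_\beta(r,\omega)=\min\{n\in\mathbb N:r_n\le\beta_n(\omega)\}$. 3. Mixed: a jointly measurable function $\mu:I\times\Omega\to\mathbb N\cup\{\infty\}$ such that $\mu(r,\cdot)$ is a stopping time for every $r\in I$; here $r\in I$ has law $\lambda$ and $\widetilde N_\mu=\mu$. For two random stopping times $\eta_1,\eta_2$ of the same class let $$\gamma^1(\eta_1,\eta_2;X)=\mathbf E\bigl[X^{1,J}_{\min\{N_1,N_2\}}(\omega)\bigr],\qquad N_j=\widetilde N_{\eta_j}(r_j,\omega),\quad J=\{j: N_j=\min\{N_1,N_2\}\},$$ where $\omega\sim P$ and the draws $r_1,r_2$ of the two players are independent. Theorem. Every two-player zero-sum stopping game has a value in randomized stopping times and a value in mixed stopping times, and both are equal to its value in behavior stopping times. That is, there is a real number $v$, the same for each of the three classes, such that $$\sup_{\eta_1}\inf_{\eta_2}\gamma^1(\eta_1,\eta_2;X)=v=\inf_{\eta_2}\sup_{\eta_1}\gamma^1(\eta_1,\eta_2;X)$$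 when $\eta_1,\eta_2$ range over the randomized stopping times, when they range over the behavior stopping times, and when they range over the mixed stopping times. -/

import Mathlib

open MeasureTheory
open scoped unitInterval

namespace StoppingGames

noncomputable section

/-- Nonempty subsets (coalitions) of the set `J` of players. -/
abbrev Coalition (J : Type*) : Type _ := {C : Finset J // C.Nonempty}

/-- A process indexed by `ℕ ∪ {∞}` is adapted to the filtration `ℱ` if its value at each finite time
`n` is `ℱ n`-measurable and its value at time `∞` is measurable for `σ(ℱ n, n ∈ ℕ)`. -/
def ExtAdapted {Ω E : Type*} {mΩ : MeasurableSpace Ω} [MeasurableSpace E]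
    (ℱ : Filtration ℕ mΩ) (X : ℕ∞ → Ω → E) : Prop :=
  (∀ n : ℕ, Measurable[ℱ n] (X n)) ∧ Measurable[⨆ n, ℱ n] (X ⊤)

/-- A stopping game with finite set of players `J`: an adapted process `(X n)`, `n ∈ ℕ ∪ {∞}`, with
values in `ℝ ^ (J × {nonempty subsets of J})`, such that `sup_n ‖X n‖` has finite expectation.
`X n ω (j, C)` is the payoff of player `j` when the game stops at time `n`, the set of players who
stop at that time being `C`. -/
structure StoppingGame (J : Type*) [Fintype J] {Ω : Type*} {mΩ : MeasurableSpace Ω}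
    (P : Measure Ω) (ℱ : Filtration ℕ mΩ) where
  X : ℕ∞ → Ω → J × Coalition J → ℝ
  adapted : ExtAdapted ℱ X
  integrable : ∫⁻ ω, ⨆ n : ℕ∞, ‖X n ω‖ₑ ∂P < ⊤

/-- The set of players whose stopping times are minimal, i.e. who stop when the game terminates. -/
def stoppers {J : Type*} [Fintype J] [Nonempty J] (s : J → ℕ∞) : Coalition J :=
  ⟨Finset.univ.filter fun j => s j = ⨅ i, s i, by
    obtain ⟨j, hj⟩ := exists_eq_ciInf_of_finite (f := s)
    exact ⟨j, by simp [hj]⟩⟩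

/-- Payoff of player `j` in state `ω` when each player `i` stops at time `s i`. -/
def StoppingGame.realizedPayoff {J : Type*} [Fintype J] [Nonempty J] {Ω : Type*}
    {mΩ : MeasurableSpace Ω} {P : Measure Ω} {ℱ : Filtration ℕ mΩ}
    (G : StoppingGame J P ℱ) (j : J) (s : J → ℕ∞) (ω : Ω) : ℝ :=
  G.X (⨅ i, s i) ω (j, stoppers s)

/-- A two-player stopping game is zero-sum if the payoffs of the two players add up to zero. -/
def StoppingGame.IsZeroSum {Ω : Type*} {mΩ : MeasurableSpace Ω} {P : Measure Ω}
    {ℱ : Filtration ℕ mΩ} (G : StoppingGame (Fin 2) P ℱ) : Prop :=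
  ∀ (n : ℕ∞) (ω : Ω) (C : Coalition (Fin 2)), G.X n ω (0, C) + G.X n ω (1, C) = 0

/-- Expected payoff of player `j` in a two-player game, when player `i` draws `r i` at random
according to `Q`, the two draws and the state `ω` being independent, and stops at
the random time `N i (r i, ω)`. -/
def StoppingGame.expectedPayoff {Ω : Type*} {mΩ : MeasurableSpace Ω} {P : Measure Ω}
    {ℱ : Filtration ℕ mΩ} (G : StoppingGame (Fin 2) P ℱ) (j : Fin 2)
    {R : Type*} [MeasurableSpace R] (Q : Measure R) (N₁ N₂ : R × Ω → ℕ∞) : ℝ :=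
  ∫ z : R × R × Ω,
    G.realizedPayoff j ![N₁ (z.1, z.2.2), N₂ (z.2.1, z.2.2)] z.2.2 ∂(Q.prod (Q.prod P))

/-! Randomized stopping times -/

/-- A randomized stopping time: a nonnegative adapted process `ρ` with `∑ ρ n = 1`, the sum being
over `n ∈ ℕ ∪ {∞}`. -/
structure RandomizedStoppingTime {Ω : Type*} {mΩ : MeasurableSpace Ω} (ℱ : Filtration ℕ mΩ) where
  ρ : ℕ∞ → Ω → ℝ
  adapted : ExtAdapted ℱ ρ
  nonneg : ∀ n ω, 0 ≤ ρ n ω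
  hasSum : ∀ ω, HasSum (fun n => ρ n ω) 1

/-- The first `n ∈ ℕ` with `ρ 0 + ⋯ + ρ n ≥ r`, and `∞` if there is none; the random draw is the
point `r` of `[0, 1]`. -/
def RandomizedStoppingTime.time {Ω : Type*} {mΩ : MeasurableSpace Ω} {ℱ : Filtration ℕ mΩ}
    (η : RandomizedStoppingTime ℱ) (z : I × Ω) : ℕ∞ :=
  ⨅ (n : ℕ) (_ : (z.1 : ℝ) ≤ ∑ k ∈ Finset.range (n + 1), η.ρ k z.2), (n : ℕ∞)

/-! Behavior stopping times -/

/-- A behavior stopping time: an adapted process with values in `[0, 1]`. -/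
structure BehaviorStoppingTime {Ω : Type*} {mΩ : MeasurableSpace Ω} (ℱ : Filtration ℕ mΩ) where
  β : ℕ → Ω → ℝ
  adapted : ∀ n, Measurable[ℱ n] (β n)
  mem_Icc : ∀ n ω, β n ω ∈ Set.Icc (0 : ℝ) 1

/-- The first `n ∈ ℕ` with `r n ≤ β n`, and `∞` if there is none; the random draw is the
sequence `r` of points of `[0, 1]`. -/
def BehaviorStoppingTime.time {Ω : Type*} {mΩ : MeasurableSpace Ω} {ℱ : Filtration ℕ mΩ}
    (η : BehaviorStoppingTime ℱ) (z : (ℕ → I) × Ω) : ℕ∞ :=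
  ⨅ (n : ℕ) (_ : (z.1 n : ℝ) ≤ η.β n z.2), (n : ℕ∞)

/-! Mixed stopping times -/

/-- A mixed stopping time: a jointly measurable function `μ` on `[0, 1] × Ω` such that `μ (r, ·)` is
a stopping time for every `r`. -/
structure MixedStoppingTime {Ω : Type*} {mΩ : MeasurableSpace Ω} (ℱ : Filtration ℕ mΩ) where
  μ : I × Ω → ℕ∞
  measurable : Measurable μ
  isStoppingTime : ∀ r : I, IsStoppingTime ℱ fun ω => μ (r, ω)

/-! Payoffs and values -/

variable {Ω : Type*} {mΩ : MeasurableSpace Ω} {P : Measure Ω} {ℱ : Filtration ℕ mΩ}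

/-- Payoff of player `j` for a pair of randomized stopping times: the draws are independent and
uniform in `[0, 1]`. -/
def StoppingGame.payoffRandomized (G : StoppingGame (Fin 2) P ℱ) (j : Fin 2)
    (η₁ η₂ : RandomizedStoppingTime ℱ) : ℝ :=
  G.expectedPayoff j (volume : Measure I) η₁.time η₂.time

/-- Payoff of player `j` for a pair of behavior stopping times: the draws are independent sequences
of independent uniform points of `[0, 1]`. -/
def StoppingGame.payoffBehavior (G : StoppingGame (Fin 2) P ℱ) (j : Fin 2)
    (η₁ η₂ : BehaviorStoppingTime ℱ) : ℝ :=
  G.expectedPayoff j (Measure.infinitePi fun _ : ℕ => (volume : Measure I)) η₁.time η₂.time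

/-- Payoff of player `j` for a pair of mixed stopping times: the draws are independent and
uniform in `[0, 1]`. -/
def StoppingGame.payoffMixed (G : StoppingGame (Fin 2) P ℱ) (j : Fin 2)
    (η₁ η₂ : MixedStoppingTime ℱ) : ℝ :=
  G.expectedPayoff j (volume : Measure I) η₁.μ η₂.μ

/-- `v` is the value of the zero-sum game with payoff function `γ` (paid to the maximizer, who
chooses the first argument): `sup inf γ = v = inf sup γ`. Extrema are taken in the extended reals,
so that they are the true ones. -/
def IsValue {S T : Type*} (γ : S → T → ℝ) (v : ℝ) : Prop :=
  (⨆ s, ⨅ t, (γ s t : EReal)) = (v : EReal) ∧ (⨅ t, ⨆ s, (γ s t : EReal)) = (v : EReal)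

end

end StoppingGames

/-! Write A, B, C for the payoff to player 1 (the maximizer) when he stops alone, when his opponent
stops alone, and when both stop together or never. Each stage is a 2 × 2 matrix game whose "nobody
stops" entry is the conditional expectation of the continuation value. Interrupt the game at a
finite horizon and pay there `tailMax`, the best the maximizer could still obtain from an opponent
who never stops. The resulting values decrease as the horizon grows; the value of the game is the
integral of their limit V at time 0 (`limitValue`).

The minimizer plays optimally up to a horizon T and never stops afterwards. What the maximizer
collects after T is then at most `tailMax`, so the payoff is at most the value of the truncated
game, which tends to the integral of V 0 (`integral_pay_truncStrategy_le`).

For the maximizer, V is a subsolution of the dynamic programming equation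
(`limitValue_le_matrixValue`). Optimal play in the stage games therefore secures the integral of V 0
in the auxiliary game where never stopping pays L, the limit of `tailMax`
(`integral_limitValue_le`). The true payoff of never stopping may be smaller than L, but then
payoffs A close to L recur forever. So from a late time m on, when L is close to u = E[L | ℱ m], he
stops with small probability δ whenever A ≥ u - ε: recurring opportunities are almost surely taken
in the end, while simultaneous stopping has probability at most δ. An opponent who stops late at B >
u does no better than one who never stops in the auxiliary game, whence `reluctantTime`;
`pay_withTail_le` compares the two games path by path.

Both guarantees hold against pure stopping times. Against these, a random time matters only through
its conditional law given ω (`Realizes.map_eq`), each of the three classes realizes the laws of all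
behavior stopping times, and fixing the draw of an opponent from any class leaves a stopping time.
Integration over that draw gives the same value in the three classes. -/

namespace StoppingGames

noncomputable section

open Filter Topology

section

/-! The value of a `2 × 2` matrix game. The maximizer chooses the first row (stop) with probability
`x`, the minimizer the first column (stop) with probability `y`; the rows are `(c, a)` and
`(b, d)`. -/

/-- What the row player guarantees by stopping with probability `x`. -/
def rowGuarantee (a b c d x : ℝ) : ℝ :=
  min (x * c + (1 - x) * b) (x * a + (1 - x) * d)

/-- An optimal probability of stopping for the row player. -/
def rowOptimal (a b c d : ℝ) : ℝ :=
  if 0 ≤ c - b ∧ 0 ≤ a - d then 1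
  else if c - b ≤ 0 ∧ a - d ≤ 0 then 0
  -- Neither row dominates, so the payoffs against the two columns are affine in `x` with slopes of
  -- opposite sign; their minimum is largest at the crossing point, clipped to `[0, 1]`.
  else max 0 (min 1 ((d - b) / ((c - b) - (a - d))))

/-- An optimal probability of stopping for the column player. -/
def colOptimal (a b c d : ℝ) : ℝ := rowOptimal (-b) (-a) (-c) (-d)

/-- The value of the matrix game. -/
def matrixValue (a b c d : ℝ) : ℝ := rowGuarantee a b c d (rowOptimal a b c d)

lemma rowOptimal_nonneg (a b c d : ℝ) : 0 ≤ rowOptimal a b c d := by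
  unfold rowOptimal; split_ifs <;> simp

lemma rowOptimal_le_one (a b c d : ℝ) : rowOptimal a b c d ≤ 1 := by
  unfold rowOptimal; split_ifs <;> simp

/-- The minimax theorem for 2 × 2 matrices, by cases. If a row dominates or the crossing point is
clipped, a pure column works; at a true crossing, the column mixture that equalizes the two rows
does. -/
lemma exists_le_matrixValue (a b c d : ℝ) : ∃ y : ℝ, 0 ≤ y ∧ y ≤ 1 ∧
    y * c + (1 - y) * a ≤ matrixValue a b c d ∧ y * b + (1 - y) * d ≤ matrixValue a b c d := by
  have pure (x : ℝ) (hx : rowOptimal a b c d = x) (y : ℝ) (hy : y = 0 ∨ y = 1)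
      (h : y * c + (1 - y) * a ≤ x * c + (1 - x) * b ∧ y * c + (1 - y) * a ≤ x * a + (1 - x) * d ∧
        y * b + (1 - y) * d ≤ x * c + (1 - x) * b ∧ y * b + (1 - y) * d ≤ x * a + (1 - x) * d) :
      ∃ y : ℝ, 0 ≤ y ∧ y ≤ 1 ∧
      y * c + (1 - y) * a ≤ matrixValue a b c d ∧ y * b + (1 - y) * d ≤ matrixValue a b c d := by
    refine ⟨y, ?_, ?_, ?_, ?_⟩
    · rcases hy with rfl | rfl <;> simp
    · rcases hy with rfl | rfl <;> simp
    · rw [matrixValue, hx]; exact le_min h.1 h.2.1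
    · rw [matrixValue, hx]; exact le_min h.2.2.1 h.2.2.2
  by_cases h1 : 0 ≤ c - b ∧ 0 ≤ a - d
  · have hx : rowOptimal a b c d = 1 := if_pos h1
    obtain ⟨h1, h1'⟩ := h1
    rcases le_total c a with h | h
    · exact pure 1 hx 1 (Or.inr rfl) (by refine ⟨?_, ?_, ?_, ?_⟩ <;> linarith)
    · exact pure 1 hx 0 (Or.inl rfl) (by refine ⟨?_, ?_, ?_, ?_⟩ <;> linarith)
  by_cases h2 : c - b ≤ 0 ∧ a - d ≤ 0
  · have hx : rowOptimal a b c d = 0 := by rw [rowOptimal, if_neg h1, if_pos h2]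
    obtain ⟨h2, h2'⟩ := h2
    rcases le_total b d with h | h
    · exact pure 0 hx 1 (Or.inr rfl) (by refine ⟨?_, ?_, ?_, ?_⟩ <;> linarith)
    · exact pure 0 hx 0 (Or.inl rfl) (by refine ⟨?_, ?_, ?_, ?_⟩ <;> linarith)
  have hx : rowOptimal a b c d = max 0 (min 1 ((d - b) / ((c - b) - (a - d)))) := by
    rw [rowOptimal, if_neg h1, if_neg h2]
  have hs : (0 < c - b ∧ a - d < 0) ∨ (c - b < 0 ∧ 0 < a - d) := by
    rcases lt_or_ge 0 (c - b) with h | h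
    · exact Or.inl ⟨h, lt_of_not_ge fun h' => h1 ⟨h.le, h'⟩⟩
    · have h' : 0 < a - d := lt_of_not_ge fun h' => h2 ⟨h, h'⟩
      exact Or.inr ⟨lt_of_not_ge fun h'' => h1 ⟨h'', h'.le⟩, h'⟩
  have hD : (c - b) - (a - d) ≠ 0 := by rcases hs with hs | hs <;> intro h <;> linarith
  set q := (d - b) / ((c - b) - (a - d)) with hq
  have hqD : q * ((c - b) - (a - d)) = d - b := by rw [hq]; field_simp
  by_cases hq0 : q ≤ 0
  · have hx0 : rowOptimal a b c d = 0 := by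
      rw [hx]; exact max_eq_left ((min_le_right _ _).trans hq0)
    rcases hs with ⟨hs, hs'⟩ | ⟨hs, hs'⟩
    · have : d - b ≤ 0 := by nlinarith
      exact pure 0 hx0 0 (Or.inl rfl) (by refine ⟨?_, ?_, ?_, ?_⟩ <;> linarith)
    · have : 0 ≤ d - b := by nlinarith
      exact pure 0 hx0 1 (Or.inr rfl) (by refine ⟨?_, ?_, ?_, ?_⟩ <;> linarith)
  by_cases hq1 : 1 ≤ q
  · have hx1 : rowOptimal a b c d = 1 := by
      rw [hx, min_eq_left hq1]; simp
    rcases hs with ⟨hs, hs'⟩ | ⟨hs, hs'⟩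
    · have : (c - b) - (a - d) ≤ d - b := by nlinarith
      exact pure 1 hx1 1 (Or.inr rfl) (by refine ⟨?_, ?_, ?_, ?_⟩ <;> linarith)
    · have : d - b ≤ (c - b) - (a - d) := by nlinarith
      exact pure 1 hx1 0 (Or.inl rfl) (by refine ⟨?_, ?_, ?_, ?_⟩ <;> linarith)
  have hxq : rowOptimal a b c d = q := by
    rw [hx, min_eq_right (le_of_not_ge hq1), max_eq_right (le_of_not_ge hq0)]
  have hval : matrixValue a b c d = q * c + (1 - q) * b := by
    rw [matrixValue, hxq, rowGuarantee, min_eq_left]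
    linarith
  set D := (c - b) - (a - d) with hDdef
  -- The weight making both rows pay the same; the common payoff turns out to be that of `q`.
  set y := -(a - d) / D with hy
  have hyD : y * D = -(a - d) := by rw [hy]; field_simp
  have key1 : y * c + (1 - y) * a = q * c + (1 - q) * b := by
    apply mul_left_cancel₀ hD
    linear_combination (c - a) * hyD - (c - b) * hqD + (a - b) * hDdef
  have key2 : y * b + (1 - y) * d = q * c + (1 - q) * b := by
    apply mul_left_cancel₀ hD
    linear_combination (b - d) * hyD - (c - b) * hqD + (d - b) * hDdef
  refine ⟨y, ?_, ?_, by rw [hval, key1], by rw [hval, key2]⟩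
  · rcases hs with ⟨hs, hs'⟩ | ⟨hs, hs'⟩
    · exact div_nonneg (by linarith) (by linarith)
    · exact div_nonneg_of_nonpos (by linarith) (by linarith)
  · rcases hs with ⟨hs, hs'⟩ | ⟨hs, hs'⟩
    · rw [hy, div_le_one (by linarith)]; linarith
    · rw [hy, div_le_one_of_neg (by linarith)]; linarith

lemma matrixValue_le_rowOptimal (a b c d : ℝ) :
    matrixValue a b c d ≤ rowOptimal a b c d * c + (1 - rowOptimal a b c d) * b ∧
    matrixValue a b c d ≤ rowOptimal a b c d * a + (1 - rowOptimal a b c d) * d :=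
  ⟨min_le_left _ _, min_le_right _ _⟩

/-- `colOptimal` is the row solution of the negated transpose, so it caps the payoff at minus the
value of that matrix. Weak duality, from pitting the two existential strategies against each other,
bounds this cap by `matrixValue`. -/
lemma colOptimal_le_matrixValue (a b c d : ℝ) :
    colOptimal a b c d * c + (1 - colOptimal a b c d) * a ≤ matrixValue a b c d ∧
    colOptimal a b c d * b + (1 - colOptimal a b c d) * d ≤ matrixValue a b c d := by
  obtain ⟨x, hx0, hx1, h1, h2⟩ := exists_le_matrixValue (-b) (-a) (-c) (-d)
  obtain ⟨y, hy0, hy1, h3, h4⟩ := exists_le_matrixValue a b c d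
  obtain ⟨h5, h6⟩ := matrixValue_le_rowOptimal (-b) (-a) (-c) (-d)
  set Y := rowOptimal (-b) (-a) (-c) (-d) with hY
  have hc : colOptimal a b c d = Y := rfl
  have weak : -(matrixValue (-b) (-a) (-c) (-d)) ≤ matrixValue a b c d := by
    have e1 := mul_le_mul_of_nonneg_left h1 hy0
    have e2 := mul_le_mul_of_nonneg_left h2 (sub_nonneg.2 hy1)
    have e3 := mul_le_mul_of_nonneg_left h3 hx0
    have e4 := mul_le_mul_of_nonneg_left h4 (sub_nonneg.2 hx1)
    linarith
  rw [hc]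
  constructor <;> linarith

lemma colOptimal_nonneg (a b c d : ℝ) : 0 ≤ colOptimal a b c d := rowOptimal_nonneg ..

lemma colOptimal_le_one (a b c d : ℝ) : colOptimal a b c d ≤ 1 := rowOptimal_le_one ..

/-- Let the row player be optimal for `d'` and the column player for `d`: the entry where nobody
stops is reached with probability `(1 - x) * (1 - y)`, which lies between 0 and 1. This gives both
monotonicity and the Lipschitz bound in the continuation payoff. -/
lemma matrixValue_sub_le (a b c d d' : ℝ) :
    matrixValue a b c d' - matrixValue a b c d ≤ max (d' - d) 0 := by
  obtain ⟨h1, h2⟩ := matrixValue_le_rowOptimal a b c d'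
  obtain ⟨h3, h4⟩ := colOptimal_le_matrixValue a b c d
  have hx0 := rowOptimal_nonneg a b c d'
  have hx1 := rowOptimal_le_one a b c d'
  have hy0 := colOptimal_nonneg a b c d
  have hy1 := colOptimal_le_one a b c d
  set x := rowOptimal a b c d'
  set y := colOptimal a b c d
  have e1 := mul_le_mul_of_nonneg_left h1 hy0
  have e2 := mul_le_mul_of_nonneg_left h2 (sub_nonneg.2 hy1)
  have e3 := mul_le_mul_of_nonneg_left h3 hx0
  have e4 := mul_le_mul_of_nonneg_left h4 (sub_nonneg.2 hx1)
  have h : matrixValue a b c d' - matrixValue a b c d ≤ ((1 - x) * (1 - y)) * (d' - d) := by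
    linarith
  have hp0 : 0 ≤ (1 - x) * (1 - y) := mul_nonneg (by linarith) (by linarith)
  have hp1 : (1 - x) * (1 - y) ≤ 1 := by nlinarith
  have h5 : (1 - x) * (1 - y) * (d' - d) ≤ (1 - x) * (1 - y) * max (d' - d) 0 :=
    mul_le_mul_of_nonneg_left (le_max_left _ _) hp0
  have h6 : (1 - x) * (1 - y) * max (d' - d) 0 ≤ 1 * max (d' - d) 0 :=
    mul_le_mul_of_nonneg_right hp1 (le_max_right _ _)
  linarith

lemma matrixValue_mono {a b c d d' : ℝ} (h : d ≤ d') :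
    matrixValue a b c d ≤ matrixValue a b c d' := by
  have := matrixValue_sub_le a b c d' d
  rw [max_eq_right (by linarith)] at this
  linarith

/-- The column player may always decline to stop, leaving only `a` and `d`. -/
lemma matrixValue_le_max (a b c d : ℝ) : matrixValue a b c d ≤ max a d := by
  have h := (matrixValue_le_rowOptimal a b c d).2
  have hx0 := rowOptimal_nonneg a b c d
  have hx1 := rowOptimal_le_one a b c d
  have e1 := mul_le_mul_of_nonneg_left (le_max_left a d) hx0
  have e2 := mul_le_mul_of_nonneg_left (le_max_right a d) (sub_nonneg.2 hx1)
  linarith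

lemma le_matrixValue {a b c d K : ℝ} (ha : K ≤ a) (hb : K ≤ b) (hc : K ≤ c) (hd : K ≤ d) :
    K ≤ matrixValue a b c d := by
  have hx0 := rowOptimal_nonneg a b c d
  have hx1 := rowOptimal_le_one a b c d
  refine le_min ?_ ?_
  · have e1 := mul_le_mul_of_nonneg_left hc hx0
    have e2 := mul_le_mul_of_nonneg_left hb (sub_nonneg.2 hx1)
    linarith
  · have e1 := mul_le_mul_of_nonneg_left ha hx0
    have e2 := mul_le_mul_of_nonneg_left hd (sub_nonneg.2 hx1)
    linarith

section Measurability

variable {α : Type*} {mα : MeasurableSpace α} {a b c d : α → ℝ}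

lemma _root_.Measurable.rowOptimal (ha : Measurable a) (hb : Measurable b) (hc : Measurable c)
    (hd : Measurable d) : Measurable fun ω => rowOptimal (a ω) (b ω) (c ω) (d ω) := by
  unfold StoppingGames.rowOptimal
  refine Measurable.ite ?_ measurable_const (Measurable.ite ?_ measurable_const (by fun_prop))
  · exact (measurableSet_le measurable_const (hc.sub hb)).inter
      (measurableSet_le measurable_const (ha.sub hd))
  · exact (measurableSet_le (hc.sub hb) measurable_const).inter
      (measurableSet_le (ha.sub hd) measurable_const)

lemma _root_.Measurable.colOptimal (ha : Measurable a) (hb : Measurable b) (hc : Measurable c)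
    (hd : Measurable d) : Measurable fun ω => colOptimal (a ω) (b ω) (c ω) (d ω) :=
  Measurable.rowOptimal hb.neg ha.neg hc.neg hd.neg

lemma _root_.Measurable.matrixValue (ha : Measurable a) (hb : Measurable b) (hc : Measurable c)
    (hd : Measurable d) : Measurable fun ω => matrixValue (a ω) (b ω) (c ω) (d ω) := by
  have hx := ha.rowOptimal hb hc hd
  unfold StoppingGames.matrixValue rowGuarantee
  fun_prop

end Measurability

end

section

/-! Payoff processes of a zero-sum game, truncated games and their values -/

/-- Payoff processes to the maximizer: `A` when he stops alone, `B` when his opponent stops alone,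
`C` when both stop simultaneously or never; all of them are dominated by `H`. -/
structure PayoffProcesses {Ω : Type*} {mΩ : MeasurableSpace Ω} (P : Measure Ω) (ℱ : Filtration ℕ mΩ)
    (A B C : ℕ∞ → Ω → ℝ) (H : Ω → ℝ) : Prop where
  adapted_A : ∀ n : ℕ, Measurable[ℱ n] (A n)
  adapted_B : ∀ n : ℕ, Measurable[ℱ n] (B n)
  adapted_C : ∀ n : ℕ, Measurable[ℱ n] (C n)
  measurable_A_top : Measurable (A ⊤)
  measurable_B_top : Measurable (B ⊤)
  measurable_C_top : Measurable (C ⊤)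
  integrable : Integrable H P
  bound : ∀ᵐ ω ∂P, ∀ n, |A n ω| ≤ H ω ∧ |B n ω| ≤ H ω ∧ |C n ω| ≤ H ω

/-- The largest payoff available to the maximizer from time `n` on if his opponent never stops. -/
def tailMax {Ω : Type*} (A C : ℕ∞ → Ω → ℝ) (n : ℕ) (ω : Ω) : ℝ :=
  max (C ⊤ ω) (⨆ k : ℕ, A ((n + k : ℕ) : ℕ∞) ω)

/-- The value at time `n` of the game in which the maximizer receives `tailMax` if nobody stops
before time `n + j`. -/
def truncValue {Ω : Type*} {mΩ : MeasurableSpace Ω} (P : Measure Ω) (ℱ : Filtration ℕ mΩ)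
    (A B C : ℕ∞ → Ω → ℝ) : ℕ → ℕ → Ω → ℝ
  | 0, n => P[tailMax A C n | ℱ n]
  | j + 1, n => fun ω => matrixValue (A n ω) (B n ω) (C n ω)
      ((P[truncValue P ℱ A B C j (n + 1) | ℱ n]) ω)

/-- The limit of the values of the truncated games. -/
def limitValue {Ω : Type*} {mΩ : MeasurableSpace Ω} (P : Measure Ω) (ℱ : Filtration ℕ mΩ)
    (A B C : ℕ∞ → Ω → ℝ) (n : ℕ) (ω : Ω) : ℝ :=
  ⨅ j, truncValue P ℱ A B C j n ω

/-- The limit of `tailMax`. -/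
def tailLimit {Ω : Type*} (A C : ℕ∞ → Ω → ℝ) (ω : Ω) : ℝ := ⨅ n, tailMax A C n ω

lemma measurable_ennat_index {α : Type*} {mα : MeasurableSpace α} {A : ℕ∞ → α → ℝ}
    (hA : ∀ n : ℕ, Measurable (A n)) (hA' : Measurable (A ⊤)) (n : ℕ∞) : Measurable (A n) := by
  induction n with
  | top => exact hA'
  | coe n => exact hA n

variable {Ω : Type*} {mΩ : MeasurableSpace Ω} {P : Measure Ω} {ℱ : Filtration ℕ mΩ}
  {A B C : ℕ∞ → Ω → ℝ} {H : Ω → ℝ}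

namespace PayoffProcesses

section

variable (h : PayoffProcesses P ℱ A B C H)
include h

lemma measurable_A (n : ℕ∞) : Measurable (A n) :=
  measurable_ennat_index (fun n => (h.adapted_A n).mono (ℱ.le n) le_rfl) h.measurable_A_top n

lemma measurable_B (n : ℕ∞) : Measurable (B n) :=
  measurable_ennat_index (fun n => (h.adapted_B n).mono (ℱ.le n) le_rfl) h.measurable_B_top n

lemma measurable_C (n : ℕ∞) : Measurable (C n) :=
  measurable_ennat_index (fun n => (h.adapted_C n).mono (ℱ.le n) le_rfl) h.measurable_C_top n

lemma measurable_tailMax (n : ℕ) : Measurable (tailMax A C n) :=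
  (h.measurable_C ⊤).max (Measurable.iSup fun _ => h.measurable_A _)

lemma measurable_tailLimit : Measurable (tailLimit A C) :=
  Measurable.iInf fun n => h.measurable_tailMax n

/-- The negated processes, with the roles of the players exchanged. -/
lemma swap_neg : PayoffProcesses P ℱ (fun n ω => -B n ω) (fun n ω => -A n ω) (fun n ω => -C n ω) H
    where
  adapted_A n := (h.adapted_B n).neg
  adapted_B n := (h.adapted_A n).neg
  adapted_C n := (h.adapted_C n).neg
  measurable_A_top := h.measurable_B_top.neg
  measurable_B_top := h.measurable_A_top.neg
  measurable_C_top := h.measurable_C_top.neg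
  integrable := h.integrable
  bound := by
    filter_upwards [h.bound] with ω hω n
    simpa using ⟨(hω n).2.1, (hω n).1, (hω n).2.2⟩

end

/-! ### Pathwise properties of `tailMax` and its limit -/

lemma bddAbove_range {ω : Ω} (hω : ∀ n, |A n ω| ≤ H ω) (n : ℕ) :
    BddAbove (Set.range fun k : ℕ => A ((n + k : ℕ) : ℕ∞) ω) :=
  ⟨H ω, by rintro _ ⟨k, rfl⟩; exact (abs_le.1 (hω _)).2⟩

lemma abs_tailMax_le {ω : Ω} (hA : ∀ n, |A n ω| ≤ H ω) (hC : |C ⊤ ω| ≤ H ω) (n : ℕ) :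
    |tailMax A C n ω| ≤ H ω :=
  abs_le.2 ⟨(abs_le.1 hC).1.trans (le_max_left _ _),
    max_le (abs_le.1 hC).2 (ciSup_le fun _ => (abs_le.1 (hA _)).2)⟩

lemma le_tailMax {ω : Ω} (hA : ∀ n, |A n ω| ≤ H ω) {m n : ℕ} (hmn : m ≤ n) :
    A n ω ≤ tailMax A C m ω := by
  obtain ⟨k, rfl⟩ := Nat.exists_eq_add_of_le hmn
  exact (le_ciSup (bddAbove_range hA m) k).trans (le_max_right _ _)

lemma antitone_tailMax {ω : Ω} (hA : ∀ n, |A n ω| ≤ H ω) : Antitone fun n => tailMax A C n ω := by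
  intro m n hmn
  refine max_le (le_max_left _ _) (ciSup_le fun k => ?_)
  exact le_tailMax hA (by omega)

lemma tendsto_tailMax {ω : Ω} (hA : ∀ n, |A n ω| ≤ H ω) (hC : |C ⊤ ω| ≤ H ω) :
    Tendsto (fun n => tailMax A C n ω) atTop (𝓝 (tailLimit A C ω)) :=
  tendsto_atTop_ciInf (antitone_tailMax hA)
    ⟨-H ω, by rintro _ ⟨n, rfl⟩; exact (abs_le.1 (abs_tailMax_le hA hC n)).1⟩

lemma abs_tailLimit_le {ω : Ω} (hA : ∀ n, |A n ω| ≤ H ω) (hC : |C ⊤ ω| ≤ H ω) :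
    |tailLimit A C ω| ≤ H ω :=
  le_of_tendsto (tendsto_tailMax hA hC).abs (Eventually.of_forall fun n => abs_tailMax_le hA hC n)

/-- Either never stopping yields at least `tailLimit`, or payoffs close to it are available to the
maximizer infinitely often. -/
lemma tailLimit_le_or_frequently {ω : Ω} (hA : ∀ n, |A n ω| ≤ H ω) (hC : |C ⊤ ω| ≤ H ω) :
    tailLimit A C ω ≤ C ⊤ ω ∨
      ∀ u < tailLimit A C ω, ∃ᶠ n : ℕ in atTop, u ≤ A n ω := by
  refine or_iff_not_imp_left.2 fun hlt u hu => frequently_atTop.2 fun m => ?_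
  push Not at hlt
  have h1 : tailLimit A C ω ≤ tailMax A C m ω :=
    ciInf_le ⟨-H ω, by rintro _ ⟨n, rfl⟩; exact (abs_le.1 (abs_tailMax_le hA hC n)).1⟩ m
  -- As `C ⊤ ω` lies strictly below `tailMax` at `m`, the maximum there comes from the supremum of
  -- the `A`'s.
  have h2 : max u (C ⊤ ω) < tailMax A C m ω := (max_lt hu hlt).trans_le h1
  rcases lt_max_iff.1 h2 with h3 | h3
  · exact absurd ((le_max_right _ _).trans_lt h3) (lt_irrefl _)
  · obtain ⟨k, hk⟩ := exists_lt_of_lt_ciSup h3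
    exact ⟨m + k, by omega, (le_max_left _ _).trans hk.le⟩

/-! ### Truncated values: domination, monotone limit, dynamic programming -/

section

variable (h : PayoffProcesses P ℱ A B C H)
include h

lemma integrable_tailMax (n : ℕ) : Integrable (tailMax A C n) P :=
  h.integrable.mono' (h.measurable_tailMax n).aestronglyMeasurable (by
    filter_upwards [h.bound] with ω hω
    exact abs_tailMax_le (fun n => (hω n).1) (hω ⊤).2.2 n)

lemma integrable_tailLimit : Integrable (tailLimit A C) P :=
  h.integrable.mono' h.measurable_tailLimit.aestronglyMeasurable (by
    filter_upwards [h.bound] with ω hω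
    exact abs_tailLimit_le (fun n => (hω n).1) (hω ⊤).2.2)

lemma measurable_truncValue (j n : ℕ) : Measurable[ℱ n] (truncValue P ℱ A B C j n) := by
  cases j with
  | zero => exact stronglyMeasurable_condExp.measurable
  | succ j =>
    exact Measurable.matrixValue (h.adapted_A n) (h.adapted_B n) (h.adapted_C n)
      stronglyMeasurable_condExp.measurable

variable [IsFiniteMeasure P]

omit h [IsFiniteMeasure P] in
lemma abs_condExp_le {f g : Ω → ℝ} (hf : Integrable f P) (hg : Integrable g P)
    (hfg : ∀ᵐ ω ∂P, |f ω| ≤ g ω) (m : MeasurableSpace Ω) :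
    ∀ᵐ ω ∂P, |(P[f | m]) ω| ≤ (P[g | m]) ω := by
  have h1 : P[f | m] ≤ᵐ[P] P[g | m] := condExp_mono hf hg (by
    filter_upwards [hfg] with ω hω using (abs_le.1 hω).2)
  have h2 : P[-g | m] ≤ᵐ[P] P[f | m] := condExp_mono hg.neg hf (by
    filter_upwards [hfg] with ω hω using (abs_le.1 hω).1)
  filter_upwards [h1, h2, condExp_neg g m (μ := P)] with ω h1 h2 h3
  rw [h3] at h2
  exact abs_le.2 ⟨h2, h1⟩

omit h in
lemma abs_le_condExp {f g : Ω → ℝ} {m : MeasurableSpace Ω} (hm : m ≤ mΩ) (hfm : Measurable[m] f)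
    (hg : Integrable g P) (hfg : ∀ᵐ ω ∂P, |f ω| ≤ g ω) :
    ∀ᵐ ω ∂P, |f ω| ≤ (P[g | m]) ω := by
  have hf : Integrable f P := hg.mono' (hfm.mono hm le_rfl).aestronglyMeasurable hfg
  have := abs_condExp_le hf hg hfg m
  rwa [condExp_of_stronglyMeasurable hm hfm.stronglyMeasurable hf] at this

/-- The bound by `P[H | ℱ n]` is preserved by the recursion thanks to the tower property. Being
independent of `j`, it serves as dominating function in the limit. -/
lemma abs_truncValue_le (j n : ℕ) :
    ∀ᵐ ω ∂P, |truncValue P ℱ A B C j n ω| ≤ (P[H | ℱ n]) ω := by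
  induction j generalizing n with
  | zero =>
    refine abs_condExp_le (h.integrable_tailMax n) h.integrable ?_ _
    filter_upwards [h.bound] with ω hω
    exact abs_tailMax_le (fun n => (hω n).1) (hω ⊤).2.2 n
  | succ j ih =>
    have hint : Integrable (truncValue P ℱ A B C j (n + 1)) P :=
      integrable_condExp.mono' ((h.measurable_truncValue j (n + 1)).mono (ℱ.le _)
        le_rfl).aestronglyMeasurable (ih (n + 1))
    have h1 := abs_condExp_le hint integrable_condExp (ih (n + 1)) (ℱ n)
    have h2 : P[P[H | ℱ (n + 1)] | ℱ n] =ᵐ[P] P[H | ℱ n] :=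
      condExp_condExp_of_le (ℱ.mono n.le_succ) (ℱ.le _)
    have hA := abs_le_condExp (ℱ.le n) (h.adapted_A n) h.integrable
      (by filter_upwards [h.bound] with ω hω using (hω n).1)
    have hB := abs_le_condExp (ℱ.le n) (h.adapted_B n) h.integrable
      (by filter_upwards [h.bound] with ω hω using (hω n).2.1)
    have hC := abs_le_condExp (ℱ.le n) (h.adapted_C n) h.integrable
      (by filter_upwards [h.bound] with ω hω using (hω n).2.2)
    filter_upwards [h1, h2, hA, hB, hC] with ω h1 h2 hA hB hC
    rw [h2] at h1
    rw [abs_le] at h1 hA hB hC ⊢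
    exact ⟨le_matrixValue hA.1 hB.1 hC.1 h1.1,
      (matrixValue_le_max _ _ _ _).trans (max_le hA.2 h1.2)⟩

lemma integrable_truncValue (j n : ℕ) : Integrable (truncValue P ℱ A B C j n) P :=
  integrable_condExp.mono' ((h.measurable_truncValue j n).mono (ℱ.le _)
    le_rfl).aestronglyMeasurable (h.abs_truncValue_le j n)

/-- When the horizon is extended by one stage, the minimizer can decline to stop there, which leaves
`A n` or the later `tailMax`, both at most `tailMax` at `n`. Monotonicity of `matrixValue` carries
this back to earlier times. -/
lemma truncValue_succ_le (j n : ℕ) :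
    truncValue P ℱ A B C (j + 1) n ≤ᵐ[P] truncValue P ℱ A B C j n := by
  induction j generalizing n with
  | zero =>
    have h1 : P[truncValue P ℱ A B C 0 (n + 1) | ℱ n] =ᵐ[P] P[tailMax A C (n + 1) | ℱ n] :=
      condExp_condExp_of_le (ℱ.mono n.le_succ) (ℱ.le _)
    have h2 : P[tailMax A C (n + 1) | ℱ n] ≤ᵐ[P] P[tailMax A C n | ℱ n] :=
      condExp_mono (h.integrable_tailMax _) (h.integrable_tailMax _) (by
        filter_upwards [h.bound] with ω hω
        exact antitone_tailMax (fun n => (hω n).1) n.le_succ)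
    have hAi : Integrable (A n) P := h.integrable.mono' (h.measurable_A n).aestronglyMeasurable
      (by filter_upwards [h.bound] with ω hω using (hω n).1)
    have h3 : P[A n | ℱ n] ≤ᵐ[P] P[tailMax A C n | ℱ n] :=
      condExp_mono hAi (h.integrable_tailMax _) (by
        filter_upwards [h.bound] with ω hω
        exact le_tailMax (fun n => (hω n).1) le_rfl)
    rw [condExp_of_stronglyMeasurable (ℱ.le n) (h.adapted_A n).stronglyMeasurable hAi] at h3
    filter_upwards [h1, h2, h3] with ω h1 h2 h3
    refine (matrixValue_le_max _ _ _ _).trans (max_le h3 ?_)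
    rw [h1]
    exact h2
  | succ j ih =>
    filter_upwards [condExp_mono (m := ℱ n) (h.integrable_truncValue (j + 1) (n + 1))
      (h.integrable_truncValue j (n + 1)) (ih (n + 1))] with ω hω
    exact matrixValue_mono hω

lemma bddBelow_truncValue (n : ℕ) :
    ∀ᵐ ω ∂P, BddBelow (Set.range fun j => truncValue P ℱ A B C j n ω) := by
  filter_upwards [ae_all_iff.2 fun j => h.abs_truncValue_le j n] with ω hω
  exact ⟨-(P[H | ℱ n]) ω, by rintro _ ⟨j, rfl⟩; exact (abs_le.1 (hω j)).1⟩

lemma tendsto_truncValue (n : ℕ) :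
    ∀ᵐ ω ∂P, Tendsto (fun j => truncValue P ℱ A B C j n ω) atTop
      (𝓝 (limitValue P ℱ A B C n ω)) := by
  filter_upwards [ae_all_iff.2 fun j => h.truncValue_succ_le j n, h.bddBelow_truncValue n]
    with ω h1 h2
  exact tendsto_atTop_ciInf (antitone_nat_of_succ_le h1) h2

lemma limitValue_le_truncValue (j n : ℕ) :
    limitValue P ℱ A B C n ≤ᵐ[P] truncValue P ℱ A B C j n := by
  filter_upwards [h.bddBelow_truncValue n] with ω hω
  exact ciInf_le hω j

omit [IsFiniteMeasure P] in
lemma measurable_limitValue (n : ℕ) : Measurable[ℱ n] (limitValue P ℱ A B C n) :=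
  Measurable.iInf fun j => h.measurable_truncValue j n

lemma integrable_limitValue (n : ℕ) : Integrable (limitValue P ℱ A B C n) P := by
  refine (integrable_condExp (m := ℱ n) (f := H)).mono'
    ((h.measurable_limitValue n).mono (ℱ.le n) le_rfl).aestronglyMeasurable ?_
  filter_upwards [h.tendsto_truncValue n, ae_all_iff.2 fun j => h.abs_truncValue_le j n]
    with ω h1 h2
  exact le_of_tendsto h1.abs (Eventually.of_forall h2)

lemma tendsto_integral_truncValue (n : ℕ) :
    Tendsto (fun j => ∫ ω, truncValue P ℱ A B C j n ω ∂P) atTop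
      (𝓝 (∫ ω, limitValue P ℱ A B C n ω ∂P)) :=
  tendsto_integral_of_dominated_convergence (P[H | ℱ n])
    (fun j => (h.integrable_truncValue j n).aestronglyMeasurable) integrable_condExp
    (fun j => h.abs_truncValue_le j n) (h.tendsto_truncValue n)

lemma limitValue_le_condExp (n : ℕ) :
    limitValue P ℱ A B C n ≤ᵐ[P] P[tailMax A C n | ℱ n] :=
  h.limitValue_le_truncValue 0 n

/-- The limit value is a subsolution of the dynamic programming equation. -/
lemma limitValue_le_matrixValue (n : ℕ) :
    ∀ᵐ ω ∂P, limitValue P ℱ A B C n ω ≤ matrixValue (A n ω) (B n ω) (C n ω)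
      ((P[limitValue P ℱ A B C (n + 1) | ℱ n]) ω) := by
  set V := limitValue P ℱ A B C
  set f : Ω → ℝ := fun ω => matrixValue (A n ω) (B n ω) (C n ω) ((P[V (n + 1) | ℱ n]) ω) with hf
  have hfm : Measurable[ℱ n] f := Measurable.matrixValue (h.adapted_A n) (h.adapted_B n)
    (h.adapted_C n) stronglyMeasurable_condExp.measurable
  -- The violation of the inequality is controlled, via the Lipschitz bound on `matrixValue`, by the
  -- conditional gap between truncated value and limit. The integral of this gap tends to 0 as `j`
  -- grows.
  have hle (j : ℕ) : ∀ᵐ ω ∂P, max (V n ω - f ω) 0 ≤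
      (P[truncValue P ℱ A B C j (n + 1) - V (n + 1) | ℱ n]) ω := by
    have h1 : 0 ≤ᵐ[P] P[truncValue P ℱ A B C j (n + 1) - V (n + 1) | ℱ n] :=
      condExp_nonneg (by
        filter_upwards [h.limitValue_le_truncValue j (n + 1)] with ω hω
        exact sub_nonneg.2 hω)
    filter_upwards [h.limitValue_le_truncValue (j + 1) n, h1,
      condExp_sub (h.integrable_truncValue j (n + 1)) (h.integrable_limitValue (n + 1)) (ℱ n)]
      with ω h2 h1 h3
    refine max_le ?_ h1
    have h4 := matrixValue_sub_le (A n ω) (B n ω) (C n ω) ((P[V (n + 1) | ℱ n]) ω)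
      ((P[truncValue P ℱ A B C j (n + 1) | ℱ n]) ω)
    rw [h3] at h1 ⊢
    simp only [Pi.sub_apply, Pi.zero_apply] at h1 ⊢
    rw [max_eq_left h1] at h4
    refine le_trans ?_ h4
    exact sub_le_sub_right h2 _
  have hm : AEStronglyMeasurable (fun ω => max (V n ω - f ω) 0) P :=
    ((((h.measurable_limitValue n).sub hfm).max measurable_const).mono (ℱ.le n)
      le_rfl).aestronglyMeasurable
  have hint : Integrable (fun ω => max (V n ω - f ω) 0) P :=
    integrable_condExp.mono' hm (by
      filter_upwards [hle 0] with ω hω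
      rwa [Real.norm_of_nonneg (le_max_right _ _)])
  have hzero : ∫ ω, max (V n ω - f ω) 0 ∂P ≤ 0 := by
    have ht : Tendsto (fun j => ∫ ω, truncValue P ℱ A B C j (n + 1) ω ∂P - ∫ ω, V (n + 1) ω ∂P)
        atTop (𝓝 0) := by
      rw [← sub_self (∫ ω, V (n + 1) ω ∂P)]
      exact (h.tendsto_integral_truncValue (n + 1)).sub_const _
    refine ge_of_tendsto' ht fun j => ?_
    rw [← integral_sub (h.integrable_truncValue j (n + 1)) (h.integrable_limitValue (n + 1))]
    calc _ ≤ ∫ ω, (P[truncValue P ℱ A B C j (n + 1) - V (n + 1) | ℱ n]) ω ∂P :=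
          integral_mono_ae hint integrable_condExp (hle j)
      _ = _ := integral_condExp (ℱ.le n)
  have hnn : 0 ≤ fun ω => max (V n ω - f ω) 0 := fun ω => le_max_right _ _
  have := (integral_eq_zero_iff_of_nonneg hnn hint).1
    (le_antisymm hzero (integral_nonneg hnn))
  filter_upwards [this] with ω hω
  have h5 : V n ω - f ω ≤ max (V n ω - f ω) 0 := le_max_left _ _
  rw [hω] at h5
  simpa using h5

end

end PayoffProcesses

end

section

/-! Random times and the submartingale argument -/

/-- Payoff to the maximizer when he stops at time `s` and his opponent at time `t`. -/
def pay {Ω : Type*} (A B C : ℕ∞ → Ω → ℝ) (s t : ℕ∞) (ω : Ω) : ℝ :=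
  if s < t then A s ω else if t < s then B t ω else C s ω

/-- Payoff to the maximizer when the game is interrupted at time `n` with terminal payoff `f`. -/
def stopped {Ω : Type*} (A B C : ℕ∞ → Ω → ℝ) (n : ℕ) (f : Ω → ℝ) (s t : ℕ∞) (ω : Ω) : ℝ :=
  if min s t < n then pay A B C s t ω else f ω

/-- The probability of not having stopped before time `n` when the conditional probabilities of
stopping are given by `x`. -/
def survival {Ω : Type*} (x : ℕ → Ω → ℝ) (n : ℕ) (ω : Ω) : ℝ :=
  ∏ k ∈ Finset.range n, (1 - x k ω)

/-- The random time `N`, with draws distributed according to `Q`, has conditional probabilities of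
stopping given by `x`. -/
structure Realizes {Ω : Type*} [MeasurableSpace Ω] {R : Type*} [MeasurableSpace R]
    (Q : Measure R) (N : R × Ω → ℕ∞) (x : ℕ → Ω → ℝ) : Prop where
  measurable : Measurable N
  measure_le : ∀ (ω : Ω) (n : ℕ), Q {r | (n : ℕ∞) ≤ N (r, ω)} = ENNReal.ofReal (survival x n ω)

variable {Ω : Type*} {mΩ : MeasurableSpace Ω} {P : Measure Ω} {ℱ : Filtration ℕ mΩ}
  {A B C : ℕ∞ → Ω → ℝ} {H : Ω → ℝ} {R : Type*} [MeasurableSpace R] {Q : Measure R}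

lemma eq_natCast_iff (s : ℕ∞) (n : ℕ) :
    s = n ↔ (n : ℕ∞) ≤ s ∧ ¬((n + 1 : ℕ) : ℕ∞) ≤ s := by
  induction s with
  | top => simp
  | coe s => norm_cast; omega

lemma natCast_lt_succ (n : ℕ) : (n : ℕ∞) < (n : ℕ∞) + 1 := by exact_mod_cast n.lt_succ_self

lemma pay_swap_neg (s t : ℕ∞) (ω : Ω) :
    pay (fun n ω => -B n ω) (fun n ω => -A n ω) (fun n ω => -C n ω) t s ω = -pay A B C s t ω := by
  unfold pay
  rcases lt_trichotomy s t with hst | rfl | hst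
  · simp [hst, hst.not_gt]
  · simp
  · simp [hst, hst.not_gt]

lemma stopped_zero (f : Ω → ℝ) (s t : ℕ∞) (ω : Ω) : stopped A B C 0 f s t ω = f ω := by
  simp [stopped]

lemma survival_succ (x : ℕ → Ω → ℝ) (n : ℕ) (ω : Ω) :
    survival x (n + 1) ω = survival x n ω * (1 - x n ω) := Finset.prod_range_succ _ _

lemma measurableSet_lt_stoppingTime {τ : Ω → ℕ∞} (hτ : IsStoppingTime ℱ τ) (n : ℕ) :
    MeasurableSet[ℱ n] {ω | (n : ℕ∞) < τ ω} := by
  have : {ω | (n : ℕ∞) < τ ω} = {ω | τ ω ≤ (n : ℕ∞)}ᶜ := by ext; simp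
  rw [this]
  exact (hτ n).compl

lemma measurableSet_le_stoppingTime {τ : Ω → ℕ∞} (hτ : IsStoppingTime ℱ τ) (n : ℕ) :
    MeasurableSet[ℱ n] {ω | (n : ℕ∞) ≤ τ ω} := by
  cases n with
  | zero => simp
  | succ n =>
    have : {ω | ((n + 1 : ℕ) : ℕ∞) ≤ τ ω} = {ω | (n : ℕ∞) < τ ω} := by
      ext ω
      simp [ENat.add_one_le_iff]
    rw [this]
    exact ℱ.mono n.le_succ _ (measurableSet_lt_stoppingTime hτ n)

lemma measurable_stoppingTime {τ : Ω → ℕ∞} (hτ : IsStoppingTime ℱ τ) : Measurable τ := by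
  rw [ENat.measurable_iff]
  intro n
  have : τ ⁻¹' {(n : ℕ∞)} = {ω | (n : ℕ∞) ≤ τ ω} \ {ω | (n : ℕ∞) < τ ω} := by
    ext ω
    simp [le_antisymm_iff, and_comm]
  rw [this]
  exact ℱ.le n _ ((measurableSet_le_stoppingTime hτ n).diff (measurableSet_lt_stoppingTime hτ n))

namespace BehaviorStoppingTime

variable (η : BehaviorStoppingTime ℱ)

lemma survival_nonneg (n : ℕ) (ω : Ω) : 0 ≤ survival η.β n ω :=
  Finset.prod_nonneg fun k _ => sub_nonneg.2 (η.mem_Icc k ω).2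

lemma survival_succ_le (n : ℕ) (ω : Ω) : survival η.β (n + 1) ω ≤ survival η.β n ω := by
  rw [survival_succ]
  exact mul_le_of_le_one_right (η.survival_nonneg n ω) (by linarith [(η.mem_Icc n ω).1])

lemma survival_le_one (n : ℕ) (ω : Ω) : survival η.β n ω ≤ 1 :=
  Finset.prod_le_one (fun k _ => sub_nonneg.2 (η.mem_Icc k ω).2)
    fun k _ => by linarith [(η.mem_Icc k ω).1]

lemma measurable_survival {m n : ℕ} (hmn : m ≤ n + 1) : Measurable[ℱ n] (survival η.β m) := by
  unfold survival
  refine Finset.measurable_fun_prod _ fun k hk => measurable_const.sub ?_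
  exact (η.adapted k).mono (ℱ.mono (by have := Finset.mem_range.1 hk; omega)) le_rfl

end BehaviorStoppingTime

namespace Realizes

variable {N : R × Ω → ℕ∞} {η : BehaviorStoppingTime ℱ}

lemma measurable_section {x : ℕ → Ω → ℝ} (hN : Realizes Q N x) (ω : Ω) :
    Measurable fun r => N (r, ω) :=
  hN.measurable.comp measurable_prodMk_right

lemma measureReal_le (hN : Realizes Q N η.β) (ω : Ω) (n : ℕ) :
    Q.real {r | (n : ℕ∞) ≤ N (r, ω)} = survival η.β n ω := by
  rw [Measure.real, hN.measure_le, ENNReal.toReal_ofReal (η.survival_nonneg n ω)]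

lemma measureReal_eq [IsFiniteMeasure Q] (hN : Realizes Q N η.β) (ω : Ω) (n : ℕ) :
    Q.real {r | N (r, ω) = n} = survival η.β n ω * η.β n ω := by
  have h1 : {r | N (r, ω) = n} = {r | (n : ℕ∞) ≤ N (r, ω)} \ {r | ((n + 1 : ℕ) : ℕ∞) ≤ N (r, ω)} := by
    ext r
    exact eq_natCast_iff _ _
  rw [h1, measureReal_sdiff, hN.measureReal_le, hN.measureReal_le, survival_succ]
  · ring
  · intro r hr
    exact le_trans (Nat.cast_le.2 n.le_succ) (show ((n + 1 : ℕ) : ℕ∞) ≤ N (r, ω) from hr)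
  · exact hN.measurable_section ω (MeasurableSet.of_discrete (s := Set.Ici ((n + 1 : ℕ) : ℕ∞)))

/-- Reaching time `n` splits into stopping there, with conditional probability `β n`, and surviving
to `n + 1`. Here `u`, `v` are the payoffs of these outcomes and `w` is the payoff previously
attached to reaching `n`. -/
lemma integral_step [IsFiniteMeasure Q] (hN : Realizes Q N η.β) (ω : Ω) (n : ℕ) (u v w : ℝ) :
    ∫ r, (({r | N (r, ω) = n}.indicator (fun _ => u) r +
      {r | ((n + 1 : ℕ) : ℕ∞) ≤ N (r, ω)}.indicator (fun _ => v) r) -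
      {r | (n : ℕ∞) ≤ N (r, ω)}.indicator (fun _ => w) r) ∂Q =
    survival η.β n ω * (η.β n ω * u + (1 - η.β n ω) * v - w) := by
  have h1 : MeasurableSet {r | N (r, ω) = n} :=
    hN.measurable_section ω (MeasurableSet.of_discrete (s := {(n : ℕ∞)}))
  have h2 (n : ℕ) : MeasurableSet {r | (n : ℕ∞) ≤ N (r, ω)} :=
    hN.measurable_section ω (MeasurableSet.of_discrete (s := Set.Ici (n : ℕ∞)))
  have i1 := (integrable_const (μ := Q) u).indicator h1
  have i2 := (integrable_const (μ := Q) v).indicator (h2 (n + 1))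
  have i3 := (integrable_const (μ := Q) w).indicator (h2 n)
  refine (integral_sub (i1.add i2) i3).trans ?_
  rw [integral_add' i1 i2, integral_indicator_const _ h1,
    integral_indicator_const _ (h2 _), integral_indicator_const _ (h2 _), hN.measureReal_eq,
    hN.measureReal_le, hN.measureReal_le, survival_succ]
  simp only [smul_eq_mul]
  ring

end Realizes

lemma integral_mul_condExp [IsFiniteMeasure P] {m : MeasurableSpace Ω} (hm : m ≤ mΩ)
    {w f : Ω → ℝ} (hw : Measurable[m] w) (hw1 : ∀ ω, |w ω| ≤ 1) (hf : Integrable f P) :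
    ∫ ω, w ω * (P[f | m]) ω ∂P = ∫ ω, w ω * f ω ∂P := by
  have h1 := condExp_stronglyMeasurable_mul_of_bound hm hw.stronglyMeasurable hf 1
    (Eventually.of_forall hw1)
  calc _ = ∫ ω, (P[w * f | m]) ω ∂P := (integral_congr_ae h1).symm
    _ = _ := integral_condExp hm

lemma integrable_bdd_mul {w f : Ω → ℝ} (hw : Measurable w) (hw1 : ∀ ω, |w ω| ≤ 1)
    (hf : Integrable f P) : Integrable (fun ω => w ω * f ω) P :=
  hf.bdd_mul hw.aestronglyMeasurable (c := 1) (Eventually.of_forall hw1)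

/-! ### Dynamic programming inequalities for interrupted games -/

namespace PayoffProcesses

variable (h : PayoffProcesses P ℱ A B C H)
include h

lemma measurable_pay {α : Type*} {mα : MeasurableSpace α} {s t : α → ℕ∞} {g : α → Ω}
    (hs : Measurable s) (ht : Measurable t) (hg : Measurable g) :
    Measurable fun z => pay A B C (s z) (t z) (g z) := by
  have h1 : Measurable fun p : (ℕ∞ × ℕ∞) × Ω => pay A B C p.1.1 p.1.2 p.2 := by
    refine measurable_from_prod_countable_right fun p => ?_
    change Measurable fun ω => pay A B C p.1 p.2 ω
    unfold pay
    split_ifs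
    exacts [h.measurable_A _, h.measurable_B _, h.measurable_C _]
  exact h1.comp ((hs.prodMk ht).prodMk hg)

omit h in
lemma abs_pay_le {ω : Ω} (hω : ∀ n, |A n ω| ≤ H ω ∧ |B n ω| ≤ H ω ∧ |C n ω| ≤ H ω) (s t : ℕ∞) :
    |pay A B C s t ω| ≤ H ω := by
  unfold pay
  split_ifs
  exacts [(hω _).1, (hω _).2.1, (hω _).2.2]

lemma ae_bound [SFinite P] (Q : Measure R) : ∀ᵐ z : R × Ω ∂(Q.prod P),
    ∀ n, |A n z.2| ≤ H z.2 ∧ |B n z.2| ≤ H z.2 ∧ |C n z.2| ≤ H z.2 :=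
  Measure.quasiMeasurePreserving_snd.ae h.bound

variable [IsFiniteMeasure P] [IsProbabilityMeasure Q]

lemma integrable_pay {s t : R × Ω → ℕ∞} (hs : Measurable s) (ht : Measurable t) :
    Integrable (fun z => pay A B C (s z) (t z) z.2) (Q.prod P) :=
  (h.integrable.comp_snd Q).mono' (h.measurable_pay hs ht measurable_snd).aestronglyMeasurable (by
    filter_upwards [h.ae_bound Q] with z hz
    exact abs_pay_le hz _ _)

lemma integrable_stopped {s t : R × Ω → ℕ∞} (hs : Measurable s) (ht : Measurable t) (n : ℕ)
    {f : Ω → ℝ} (hf : Integrable f P) :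
    Integrable (fun z => stopped A B C n f (s z) (t z) z.2) (Q.prod P) := by
  have hm : MeasurableSet {z : R × Ω | min (s z) (t z) < n} :=
    (hs.prodMk ht) (MeasurableSet.of_discrete (s := {p : ℕ∞ × ℕ∞ | min p.1 p.2 < n}))
  exact Integrable.piecewise (s := {z : R × Ω | min (s z) (t z) < n}) hm
    (h.integrable_pay hs ht).integrableOn (hf.comp_snd Q).integrableOn

variable {N : R × Ω → ℕ∞} {η : BehaviorStoppingTime ℱ} {τ : Ω → ℕ∞}

/-- One step of the dynamic programming inequality. -/
lemma integral_stopped_le_succ (hN : Realizes Q N η.β) (hτ : IsStoppingTime ℱ τ) (n : ℕ)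
    {V V' : Ω → ℝ} (hV : Integrable V P) (hV' : Integrable V' P)
    (hcol : ∀ᵐ ω ∂P, V ω ≤ η.β n ω * C n ω + (1 - η.β n ω) * B n ω)
    (hcont : ∀ᵐ ω ∂P, V ω ≤ η.β n ω * A n ω + (1 - η.β n ω) * (P[V' | ℱ n]) ω) :
    ∫ z, stopped A B C n V (N z) (τ z.2) z.2 ∂(Q.prod P) ≤
      ∫ z, stopped A B C (n + 1) V' (N z) (τ z.2) z.2 ∂(Q.prod P) := by
  have hτm : Measurable fun z : R × Ω => τ z.2 := (measurable_stoppingTime hτ).comp measurable_snd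
  have i1 := h.integrable_stopped (Q := Q) hN.measurable hτm n hV
  have i2 := h.integrable_stopped (Q := Q) hN.measurable hτm (n + 1) hV'
  set S := survival η.β n
  -- After integration over the draw, the increment is `w * V' + k`. The weight `w` of continuation
  -- is `ℱ n`-measurable, so `V'` may be replaced by its conditional expectation; then `hcont` gives
  -- the sign where `τ > n` and `hcol` where `τ = n`.
  set w : Ω → ℝ := {ω | (n : ℕ∞) < τ ω}.indicator fun ω => S ω * (1 - η.β n ω) with hw
  set k : Ω → ℝ := fun ω => if n < τ ω then S ω * (η.β n ω * A n ω - V ω)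
    else if τ ω = n then S ω * (η.β n ω * C n ω + (1 - η.β n ω) * B n ω - V ω) else 0 with hk
  have hinner (ω : Ω) : ∫ r, (stopped A B C (n + 1) V' (N (r, ω)) (τ ω) ω -
      stopped A B C n V (N (r, ω)) (τ ω) ω) ∂Q = w ω * V' ω + k ω := by
    rcases lt_trichotomy (τ ω) n with hlt | heq | hgt
    · have h1 (r : R) : stopped A B C (n + 1) V' (N (r, ω)) (τ ω) ω -
          stopped A B C n V (N (r, ω)) (τ ω) ω = 0 := by
        have h2 : min (N (r, ω)) (τ ω) < n := (min_le_right _ _).trans_lt hlt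
        have h3 : min (N (r, ω)) (τ ω) < ((n + 1 : ℕ) : ℕ∞) := h2.trans (by simp [natCast_lt_succ])
        rw [stopped, stopped, if_pos h2, if_pos h3, sub_self]
      simp [h1, hw, hk, hlt.not_gt, hlt.ne]
    · have h1 : ∫ r, (stopped A B C (n + 1) V' (N (r, ω)) (τ ω) ω -
          stopped A B C n V (N (r, ω)) (τ ω) ω) ∂Q =
          S ω * (η.β n ω * C n ω + (1 - η.β n ω) * B n ω - V ω) := by
        rw [← hN.integral_step ω n (C n ω) (B n ω) (V ω)]
        refine integral_congr_ae (Eventually.of_forall fun r => ?_)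
        simp only [Set.indicator, Set.mem_ofPred_eq, stopped, pay, heq]
        rcases lt_trichotomy (N (r, ω)) n with hs | hs | hs
        · have : N (r, ω) < ((n + 1 : ℕ) : ℕ∞) := hs.trans (by simp [natCast_lt_succ])
          have h4 : N (r, ω) < ((n : ℕ) : ℕ∞) + 1 := by simpa using this
          simp [hs, hs.ne, hs.not_ge, h4.not_ge, natCast_lt_succ]
        · simp [hs, natCast_lt_succ, (natCast_lt_succ n).not_ge]
        · have h4 : ((n : ℕ) : ℕ∞) + 1 ≤ N (r, ω) := by rwa [ENat.add_one_le_iff (by simp)]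
          simp [hs, hs.le, hs.ne', hs.not_gt, h4, natCast_lt_succ]
      rw [h1]
      simp [hw, hk, heq]
    · have h1 : ∫ r, (stopped A B C (n + 1) V' (N (r, ω)) (τ ω) ω -
          stopped A B C n V (N (r, ω)) (τ ω) ω) ∂Q =
          S ω * (η.β n ω * A n ω + (1 - η.β n ω) * V' ω - V ω) := by
        rw [← hN.integral_step ω n (A n ω) (V' ω) (V ω)]
        refine integral_congr_ae (Eventually.of_forall fun r => ?_)
        simp only [Set.indicator, Set.mem_ofPred_eq, stopped, pay]
        have h5 : ((n : ℕ) : ℕ∞) + 1 ≤ τ ω := by rwa [ENat.add_one_le_iff (by simp)]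
        rcases lt_trichotomy (N (r, ω)) n with hs | hs | hs
        · have : N (r, ω) < ((n + 1 : ℕ) : ℕ∞) := hs.trans (by simp [natCast_lt_succ])
          have h4 : N (r, ω) < ((n : ℕ) : ℕ∞) + 1 := by simpa using this
          simp [hs, hs.ne, hs.not_ge, h4.not_ge, h4]
        · simp [hs, hgt, hgt.not_gt, natCast_lt_succ, (natCast_lt_succ n).not_ge]
        · have h4 : ((n : ℕ) : ℕ∞) + 1 ≤ N (r, ω) := by rwa [ENat.add_one_le_iff (by simp)]
          simp [hs.le, hs.ne', hs.not_gt, h4, hgt.not_gt, h4.not_gt, h5.not_gt]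
      rw [h1]
      simp only [hw, hk, Set.indicator, Set.mem_ofPred_eq, hgt, if_true]
      ring
  have hwm : Measurable[ℱ n] w :=
    ((η.measurable_survival n.le_succ).mul (measurable_const.sub (η.adapted n))).indicator
      (measurableSet_lt_stoppingTime hτ n)
  have hw1 (ω : Ω) : |w ω| ≤ 1 := by
    rw [hw, Set.indicator]
    split_ifs
    · rw [← survival_succ, abs_of_nonneg (η.survival_nonneg _ _)]
      exact η.survival_le_one _ _
    · simp
  have iw := integrable_bdd_mul (hwm.mono (ℱ.le n) le_rfl) hw1 hV'
  have iw' := integrable_bdd_mul (hwm.mono (ℱ.le n) le_rfl) hw1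
    (integrable_condExp (m := ℱ n) (f := V') (μ := P))
  have ig : Integrable (fun ω => w ω * V' ω + k ω) P := by
    refine (i2.sub i1).integral_prod_right.congr (Eventually.of_forall fun ω => ?_)
    exact hinner ω
  have ik : Integrable k P :=
    (ig.sub iw).congr (Eventually.of_forall fun ω => by simp)
  rw [← sub_nonneg, ← integral_sub' i2 i1, integral_prod_symm _ (i2.sub i1)]
  calc (0 : ℝ) ≤ ∫ ω, (w ω * (P[V' | ℱ n]) ω + k ω) ∂P := by
        refine integral_nonneg_of_ae ?_
        filter_upwards [hcol, hcont] with ω h1 h2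
        have hS := η.survival_nonneg n ω
        simp only [hw, hk, Set.indicator, Set.mem_ofPred_eq, Pi.zero_apply]
        split_ifs
        · have := mul_nonneg hS (sub_nonneg.2 h2)
          linarith
        · have := mul_nonneg hS (sub_nonneg.2 h1)
          linarith
        · simp
    _ = ∫ ω, (w ω * V' ω + k ω) ∂P := by
        rw [integral_add iw' ik, integral_add iw ik, integral_mul_condExp (ℱ.le n) hwm hw1 hV']
    _ = _ := integral_congr_ae (Eventually.of_forall fun ω => (hinner ω).symm)

/-- A terminal payoff may be replaced by a variable with larger conditional expectation. -/
lemma integral_stopped_le_of_le_condExp (hN : Realizes Q N η.β) (hτ : IsStoppingTime ℱ τ) (n : ℕ)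
    {V f : Ω → ℝ} (hV : Integrable V P) (hf : Integrable f P) (hVf : V ≤ᵐ[P] P[f | ℱ n]) :
    ∫ z, stopped A B C n V (N z) (τ z.2) z.2 ∂(Q.prod P) ≤
      ∫ z, stopped A B C n f (N z) (τ z.2) z.2 ∂(Q.prod P) := by
  have hτm : Measurable fun z : R × Ω => τ z.2 := (measurable_stoppingTime hτ).comp measurable_snd
  have i1 := h.integrable_stopped (Q := Q) hN.measurable hτm n hV
  have i2 := h.integrable_stopped (Q := Q) hN.measurable hτm n hf
  set w : Ω → ℝ := {ω | (n : ℕ∞) ≤ τ ω}.indicator (survival η.β n) with hw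
  have hinner (ω : Ω) : ∫ r, (stopped A B C n f (N (r, ω)) (τ ω) ω -
      stopped A B C n V (N (r, ω)) (τ ω) ω) ∂Q = w ω * f ω - w ω * V ω := by
    rcases lt_or_ge (τ ω) n with hlt | hge
    · have h1 (r : R) : min (N (r, ω)) (τ ω) < n := (min_le_right _ _).trans_lt hlt
      simp [stopped, h1, hw, hlt.not_ge]
    · have h1 (r : R) : stopped A B C n f (N (r, ω)) (τ ω) ω -
          stopped A B C n V (N (r, ω)) (τ ω) ω =
          {r | (n : ℕ∞) ≤ N (r, ω)}.indicator (fun _ => f ω - V ω) r := by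
        rcases lt_or_ge (N (r, ω)) n with hs | hs
        · simp [stopped, hs, hs.not_ge]
        · simp [stopped, hs, hs.not_gt, hge.not_gt]
      simp_rw [h1]
      have h2 : MeasurableSet {r | (n : ℕ∞) ≤ N (r, ω)} :=
        hN.measurable_section ω (MeasurableSet.of_discrete (s := Set.Ici (n : ℕ∞)))
      rw [integral_indicator_const _ h2, hN.measureReal_le]
      simp [hw, hge, mul_sub]
  have hwm : Measurable[ℱ n] w :=
    (η.measurable_survival n.le_succ).indicator (measurableSet_le_stoppingTime hτ n)
  have hw0 (ω : Ω) : 0 ≤ w ω := Set.indicator_nonneg (fun _ _ => η.survival_nonneg _ _) _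
  have hw1 (ω : Ω) : |w ω| ≤ 1 := by
    rw [abs_of_nonneg (hw0 ω), hw, Set.indicator]
    split_ifs
    · exact η.survival_le_one _ _
    · simp
  have hwm' := hwm.mono (ℱ.le n) le_rfl
  have iwV := integrable_bdd_mul hwm' hw1 hV
  have iwf := integrable_bdd_mul hwm' hw1 hf
  have iwc := integrable_bdd_mul hwm' hw1 (integrable_condExp (m := ℱ n) (f := f) (μ := P))
  rw [← sub_nonneg, ← integral_sub' i2 i1, integral_prod_symm _ (i2.sub i1)]
  calc (0 : ℝ) ≤ ∫ ω, (w ω * (P[f | ℱ n]) ω - w ω * V ω) ∂P := by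
        refine integral_nonneg_of_ae ?_
        filter_upwards [hVf] with ω h1
        have := mul_nonneg (hw0 ω) (sub_nonneg.2 h1)
        simp only [Pi.zero_apply]
        linarith
    _ = ∫ ω, (w ω * f ω - w ω * V ω) ∂P := by
        rw [integral_sub iwc iwV, integral_sub iwf iwV, integral_mul_condExp (ℱ.le n) hwm hw1 hf]
    _ = _ := integral_congr_ae (Eventually.of_forall fun ω => (hinner ω).symm)

/-- A player who plays optimally in each one-shot game up to time `T` guarantees `∫ V 0` in the
game interrupted at time `T`. -/
lemma integral_le_integral_stopped (hN : Realizes Q N η.β) (hτ : IsStoppingTime ℱ τ) (T : ℕ)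
    {V : ℕ → Ω → ℝ} (hV : ∀ n ≤ T, Integrable (V n) P)
    (hcol : ∀ n < T, ∀ᵐ ω ∂P, V n ω ≤ η.β n ω * C n ω + (1 - η.β n ω) * B n ω)
    (hcont : ∀ n < T, ∀ᵐ ω ∂P,
      V n ω ≤ η.β n ω * A n ω + (1 - η.β n ω) * (P[V (n + 1) | ℱ n]) ω) :
    ∫ ω, V 0 ω ∂P ≤ ∫ z, stopped A B C T (V T) (N z) (τ z.2) z.2 ∂(Q.prod P) := by
  have key : ∀ n ≤ T, ∫ ω, V 0 ω ∂P ≤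
      ∫ z, stopped A B C n (V n) (N z) (τ z.2) z.2 ∂(Q.prod P) := by
    intro n
    induction n with
    | zero =>
      intro _
      simp only [stopped_zero]
      rw [integral_fun_snd (μ := Q) (ν := P) (V 0)]
      simp
    | succ n ih =>
      intro hn
      exact (ih (by omega)).trans (h.integral_stopped_le_succ hN hτ n (hV n (by omega))
        (hV (n + 1) hn) (hcol n hn) (hcont n hn))
  exact key T le_rfl

end PayoffProcesses

end

section

variable {Ω : Type*} {mΩ : MeasurableSpace Ω} {P : Measure Ω} {ℱ : Filtration ℕ mΩ}
  {A B C : ℕ∞ → Ω → ℝ} {H : Ω → ℝ} {R : Type*} [MeasurableSpace R] {Q : Measure R}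

/-! Behavior stopping times as random times -/

lemma natCast_le_iInf_iff (p : ℕ → Prop) (n : ℕ) :
    (n : ℕ∞) ≤ (⨅ (k : ℕ) (_ : p k), (k : ℕ∞)) ↔ ∀ k < n, ¬p k := by
  simp only [le_iInf_iff, Nat.cast_le]
  exact ⟨fun h k hk hp => (h k hp).not_gt hk, fun h k hp => le_of_not_gt fun hk => h k hk hp⟩

lemma measurable_of_measurableSet_le {α : Type*} {mα : MeasurableSpace α} {N : α → ℕ∞}
    (hN : ∀ n : ℕ, MeasurableSet {z | (n : ℕ∞) ≤ N z}) : Measurable N := by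
  rw [ENat.measurable_iff]
  intro n
  have : N ⁻¹' {(n : ℕ∞)} = {z | (n : ℕ∞) ≤ N z} \ {z | ((n + 1 : ℕ) : ℕ∞) ≤ N z} := by
    ext z
    exact eq_natCast_iff _ _
  rw [this]
  exact (hN n).diff (hN (n + 1))

lemma isStoppingTime_of_measurableSet_le {τ : Ω → ℕ∞}
    (hτ : ∀ n : ℕ, MeasurableSet[ℱ n] {ω | ((n + 1 : ℕ) : ℕ∞) ≤ τ ω}) : IsStoppingTime ℱ τ := by
  intro n
  have : {ω | τ ω ≤ (n : ℕ∞)} = {ω | ((n + 1 : ℕ) : ℕ∞) ≤ τ ω}ᶜ := by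
    ext ω
    simp only [Set.mem_ofPred_eq, Set.mem_compl_iff, Nat.cast_add, Nat.cast_one, not_le,
      ENat.lt_add_one_iff (ENat.natCast_ne_top n)]
  exact this ▸ (hτ n).compl

namespace BehaviorStoppingTime

variable (η : BehaviorStoppingTime ℱ)

lemma natCast_le_time_iff (z : (ℕ → I) × Ω) (n : ℕ) :
    (n : ℕ∞) ≤ η.time z ↔ ∀ k < n, η.β k z.2 < z.1 k := by
  rw [time, natCast_le_iInf_iff]
  simp

lemma isStoppingTime_time (r : ℕ → I) : IsStoppingTime ℱ fun ω => η.time (r, ω) := by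
  refine isStoppingTime_of_measurableSet_le fun n => ?_
  simp only [natCast_le_time_iff]
  have : {ω | ∀ k < n + 1, η.β k ω < (r k : ℝ)} =
      ⋂ k ∈ Finset.range (n + 1), {ω | η.β k ω < (r k : ℝ)} := by ext; simp
  rw [this]
  refine Finset.measurableSet_biInter _ fun k hk => ?_
  have hβ : Measurable[ℱ n] (η.β k) :=
    (η.adapted k).mono (ℱ.mono (Nat.lt_succ_iff.1 (Finset.mem_range.1 hk))) le_rfl
  exact hβ measurableSet_Iio

lemma realizes_time :
    Realizes (Measure.infinitePi fun _ : ℕ => (volume : Measure I)) η.time η.β where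
  measurable := by
    refine measurable_of_measurableSet_le fun n => ?_
    simp only [natCast_le_time_iff]
    have : {z : (ℕ → I) × Ω | ∀ k < n, η.β k z.2 < (z.1 k : ℝ)} =
        ⋂ k ∈ Finset.range n, {z | η.β k z.2 < (z.1 k : ℝ)} := by ext; simp
    rw [this]
    refine Finset.measurableSet_biInter _ fun k _ => measurableSet_lt ?_ ?_
    · exact ((η.adapted k).mono (ℱ.le k) le_rfl).comp measurable_snd
    · exact measurable_subtype_coe.comp ((measurable_pi_apply k).comp measurable_fst)
  measure_le ω n := by
    have h1 : {r : ℕ → I | (n : ℕ∞) ≤ η.time (r, ω)} =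
        Set.pi (Finset.range n) fun k => Set.Ioi (⟨η.β k ω, η.mem_Icc k ω⟩ : I) := by
      ext r
      simp [natCast_le_time_iff, Set.mem_pi, ← Subtype.coe_lt_coe]
    rw [h1, Measure.infinitePi_pi _ (fun _ _ => measurableSet_Ioi), survival,
      ENNReal.ofReal_prod_of_nonneg fun k _ => sub_nonneg.2 (η.mem_Icc k ω).2]
    simp

variable {η} {η' : BehaviorStoppingTime ℱ} {m : ℕ}

lemma time_eq_of_lt (hη : ∀ k < m, η.β k = η'.β k) {z : (ℕ → I) × Ω} (hz : η.time z < m) :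
    η'.time z = η.time z := by
  have key (n : ℕ) (hn : n ≤ m) : (n : ℕ∞) ≤ η.time z ↔ (n : ℕ∞) ≤ η'.time z := by
    rw [natCast_le_time_iff, natCast_le_time_iff]
    exact forall₂_congr fun k hk => by rw [hη k (by omega)]
  obtain ⟨k, hk⟩ := ENat.ne_top_iff_exists.1 (hz.trans_le le_top).ne
  rw [← hk] at hz key ⊢
  have hkm : k < m := by exact_mod_cast hz
  rw [eq_natCast_iff, ← key k hkm.le, ← key (k + 1) hkm]
  exact (eq_natCast_iff _ _).1 rfl

lemma le_time_of_le (hη : ∀ k < m, η.β k = η'.β k) {z : (ℕ → I) × Ω} (hz : (m : ℕ∞) ≤ η.time z) :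
    (m : ℕ∞) ≤ η'.time z := by
  rw [natCast_le_time_iff] at hz ⊢
  exact fun k hk => by rw [← hη k hk]; exact hz k hk

end BehaviorStoppingTime

lemma ae_prod_of_ae_ae [SFinite P] [SFinite Q] {p : R × Ω → Prop} (hp : MeasurableSet {z | p z})
    (h : ∀ᵐ ω ∂P, ∀ᵐ r ∂Q, p (r, ω)) : ∀ᵐ z ∂(Q.prod P), p z := by
  rw [ae_iff]
  change (Q.prod P) {z | p z}ᶜ = 0
  rw [Measure.prod_apply_symm hp.compl, lintegral_eq_zero_iff
    (measurable_measure_prodMk_right hp.compl)]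
  filter_upwards [h] with ω hω
  exact hω

namespace Realizes

variable {N : R × Ω → ℕ∞} {η : BehaviorStoppingTime ℱ} [IsProbabilityMeasure Q] [SFinite P]

/-- Stopping at `n` has conditional probability `survival * β n`. Only almost sure: a draw equal to
0 stops a behavior time even where `β n = 0`. -/
lemma ae_ne_zero (hN : Realizes Q N η.β) :
    ∀ᵐ z ∂(Q.prod P), ∀ n : ℕ, N z = n → η.β n z.2 ≠ 0 := by
  refine ae_all_iff.2 fun n => ae_prod_of_ae_ae ?_ (Eventually.of_forall fun ω => ?_)
  · have h1 : MeasurableSet {z | N z = n} :=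
      hN.measurable (MeasurableSet.of_discrete (s := {(n : ℕ∞)}))
    have h2 : MeasurableSet {z : R × Ω | η.β n z.2 ≠ 0} :=
      ((((η.adapted n).mono (ℱ.le n) le_rfl).comp measurable_snd) (measurableSet_singleton 0)).compl
    exact (h1.compl.union h2).congr (by ext z; simp [imp_iff_not_or])
  · by_cases h0 : η.β n ω = 0
    · have h1 := hN.measureReal_eq ω n
      rw [h0, mul_zero, measureReal_eq_zero_iff] at h1
      rw [ae_iff]
      simpa [h0] using h1
    · simp [h0]

/-- Each `n` with `β n ≥ δ` multiplies the survival probability by at most `1 - δ`; infinitely many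
of them force its limit, which bounds the probability of never stopping, to be 0. -/
lemma ae_not_frequently (hN : Realizes Q N η.β) {δ : ℝ} (hδ : 0 < δ) :
    ∀ᵐ z ∂(Q.prod P), N z = ⊤ → ¬∃ᶠ n in atTop, δ ≤ η.β n z.2 := by
  have hm : Measurable fun ω => ⨅ n, survival η.β n ω :=
    Measurable.iInf fun n => (η.measurable_survival n.le_succ).mono (ℱ.le n) le_rfl
  have hbdd (ω : Ω) : BddBelow (Set.range fun n => survival η.β n ω) :=
    ⟨0, by rintro _ ⟨n, rfl⟩; exact η.survival_nonneg n ω⟩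
  have key : ∀ᵐ z ∂(Q.prod P), N z = ⊤ → (⨅ n, survival η.β n z.2) ≠ 0 := by
    refine ae_prod_of_ae_ae ?_ (Eventually.of_forall fun ω => ?_)
    · have h1 : MeasurableSet {z | N z = ⊤} :=
        hN.measurable (MeasurableSet.of_discrete (s := {(⊤ : ℕ∞)}))
      have h2 : MeasurableSet {z : R × Ω | (⨅ n, survival η.β n z.2) ≠ 0} :=
        ((hm.comp measurable_snd) (measurableSet_singleton 0)).compl
      exact (h1.compl.union h2).congr (by ext z; simp [imp_iff_not_or])
    · by_cases h0 : (⨅ n, survival η.β n ω) = 0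
      · have h1 : Q.real {r | N (r, ω) = ⊤} ≤ 0 := by
          rw [← h0]
          refine le_ciInf fun n => ?_
          rw [← hN.measureReal_le]
          refine measureReal_mono fun r hr => ?_
          have hr' : N (r, ω) = ⊤ := hr
          change (n : ℕ∞) ≤ N (r, ω)
          rw [hr']
          exact le_top
        have h2 := le_antisymm h1 measureReal_nonneg
        rw [measureReal_eq_zero_iff] at h2
        rw [ae_iff]
        simpa [h0] using h2
      · simp [h0]
  filter_upwards [key] with z hz htop hfreq
  refine hz htop (le_antisymm ?_ (le_ciInf fun n => η.survival_nonneg n _))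
  set L := ⨅ n, survival η.β n z.2
  have ht : Tendsto (fun n => survival η.β n z.2) atTop (𝓝 L) :=
    tendsto_atTop_ciInf (antitone_nat_of_succ_le fun n => η.survival_succ_le n _) (hbdd _)
  have h3 : L ≤ L * (1 - δ) := by
    refine ge_of_tendsto_of_frequently (ht.mul_const (1 - δ)) (hfreq.mono fun n hn => ?_)
    calc L ≤ survival η.β (n + 1) z.2 := ciInf_le (hbdd _) _
      _ ≤ _ := by
        rw [survival_succ]
        exact mul_le_mul_of_nonneg_left (by linarith) (η.survival_nonneg _ _)
  by_contra hL
  push Not at hL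
  nlinarith

end Realizes

/-! The strategy of the minimizer -/

/-- Play optimally in the truncated game until time `T` and never stop afterwards. -/
def PayoffProcesses.truncStrategy (h : PayoffProcesses P ℱ A B C H) (T : ℕ) :
    BehaviorStoppingTime ℱ where
  β k ω := if k < T then colOptimal (A k ω) (B k ω) (C k ω)
    ((P[truncValue P ℱ A B C (T - k - 1) (k + 1) | ℱ k]) ω) else 0
  adapted k := by
    split_ifs
    · exact Measurable.colOptimal (h.adapted_A k) (h.adapted_B k) (h.adapted_C k)
        stronglyMeasurable_condExp.measurable
    · exact measurable_const
  mem_Icc k ω := by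
    split_ifs
    · exact ⟨colOptimal_nonneg .., colOptimal_le_one ..⟩
    · simp

namespace PayoffProcesses

variable (h : PayoffProcesses P ℱ A B C H) [IsFiniteMeasure P] [IsProbabilityMeasure Q]
include h

lemma integral_pay_truncStrategy_le {N : R × Ω → ℕ∞} {τ : Ω → ℕ∞} (T : ℕ)
    (hN : Realizes Q N (h.truncStrategy T).β) (hτ : IsStoppingTime ℱ τ) :
    ∫ z, pay A B C (τ z.2) (N z) z.2 ∂(Q.prod P) ≤ ∫ ω, truncValue P ℱ A B C T 0 ω ∂P := by
  have hτm : Measurable fun z : R × Ω => τ z.2 := (measurable_stoppingTime hτ).comp measurable_snd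
  -- In the negated game with roles exchanged the minimizer becomes the maximizer, and the lower
  -- bound proved for the latter applies; `T - k` stages remain at time `k`.
  set V : ℕ → Ω → ℝ := fun k => -truncValue P ℱ A B C (T - k) k with hV
  have hβ (k : ℕ) (hk : k < T) (ω : Ω) : (h.truncStrategy T).β k ω = colOptimal (A k ω) (B k ω)
      (C k ω) ((P[truncValue P ℱ A B C (T - k - 1) (k + 1) | ℱ k]) ω) := if_pos hk
  have hW (k : ℕ) (hk : k < T) (ω : Ω) : V k ω = -matrixValue (A k ω) (B k ω) (C k ω)
      ((P[truncValue P ℱ A B C (T - k - 1) (k + 1) | ℱ k]) ω) := by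
    have : T - k = (T - k - 1) + 1 := by omega
    rw [hV]
    simp only [Pi.neg_apply]
    rw [this, truncValue]
    simp
  have h1 := h.swap_neg.integral_le_integral_stopped hN hτ T (V := V)
    (fun n _ => (h.integrable_truncValue _ _).neg)
    (fun k hk => Eventually.of_forall fun ω => by
      rw [hW k hk, hβ k hk]
      have := (colOptimal_le_matrixValue (A k ω) (B k ω) (C k ω)
        ((P[truncValue P ℱ A B C (T - k - 1) (k + 1) | ℱ k]) ω)).1
      linarith)
    (fun k hk => by
      have h2 : V (k + 1) = -truncValue P ℱ A B C (T - k - 1) (k + 1) := rfl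
      filter_upwards [condExp_neg (truncValue P ℱ A B C (T - k - 1) (k + 1)) (ℱ k) (μ := P)]
        with ω hω
      rw [h2, hω, hW k hk, hβ k hk]
      have := (colOptimal_le_matrixValue (A k ω) (B k ω) (C k ω)
        ((P[truncValue P ℱ A B C (T - k - 1) (k + 1) | ℱ k]) ω)).2
      simp only [Pi.neg_apply]
      linarith)
  have h2 := h.swap_neg.integral_stopped_le_of_le_condExp hN hτ T (V := V T)
    (f := -tailMax A C T) (h.integrable_truncValue _ _).neg (h.integrable_tailMax T).neg (by
      filter_upwards [condExp_neg (tailMax A C T) (ℱ T) (μ := P)] with ω hω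
      rw [hω, hV]
      simp [truncValue])
  -- If nobody has stopped before `T`, the minimizer almost surely never stops, so the maximizer
  -- receives some `A t` with `t ≥ T` or `C ⊤`: at most `tailMax` at `T`.
  have h3 : ∫ z, stopped (fun n ω => -B n ω) (fun n ω => -A n ω) (fun n ω => -C n ω) T
      (-tailMax A C T) (N z) (τ z.2) z.2 ∂(Q.prod P) ≤
      ∫ z, -pay A B C (τ z.2) (N z) z.2 ∂(Q.prod P) := by
    refine integral_mono_ae (h.swap_neg.integrable_stopped hN.measurable hτm T
      (h.integrable_tailMax T).neg) (h.integrable_pay hτm hN.measurable).neg ?_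
    filter_upwards [h.ae_bound Q, hN.ae_ne_zero (P := P)] with z hz hz'
    rw [stopped, pay_swap_neg]
    split_ifs with hlt
    · exact le_rfl
    · push Not at hlt
      have hNtop : N z = ⊤ := by
        by_contra hne
        obtain ⟨n, hn⟩ := ENat.ne_top_iff_exists.1 hne
        refine hz' n hn.symm ?_
        have : T ≤ n := by
          have := hlt.trans (min_le_left _ _)
          rw [← hn] at this
          exact_mod_cast this
        exact if_neg this.not_gt
      have hA := fun n => (hz n).1
      rw [hNtop, Pi.neg_apply, neg_le_neg_iff, pay]
      have hT : (T : ℕ∞) ≤ τ z.2 := hlt.trans (min_le_right _ _)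
      generalize τ z.2 = t at hT
      induction t with
      | top =>
        rw [if_neg (lt_irrefl _), if_neg (lt_irrefl _)]
        exact le_max_left _ _
      | coe t => simpa using le_tailMax hA (by exact_mod_cast hT)
  rw [integral_neg] at h3
  have h4 : ∫ ω, V 0 ω ∂P = -∫ ω, truncValue P ℱ A B C T 0 ω ∂P := by
    rw [← integral_neg]
    rfl
  linarith

end PayoffProcesses

end

section

variable {Ω : Type*} {mΩ : MeasurableSpace Ω} {P : Measure Ω} {ℱ : Filtration ℕ mΩ}
  {A B C : ℕ∞ → Ω → ℝ} {H : Ω → ℝ} {R : Type*} [MeasurableSpace R] {Q : Measure R}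

/-! The strategy of the maximizer -/

/-- The process `C` with its value at `∞` replaced by `f`. -/
def withTail (C : ℕ∞ → Ω → ℝ) (f : Ω → ℝ) (n : ℕ∞) (ω : Ω) : ℝ := if n = ⊤ then f ω else C n ω

lemma pay_withTail {f : Ω → ℝ} {s t : ℕ∞} (hst : min s t < ⊤) (ω : Ω) :
    pay A B (withTail C f) s t ω = pay A B C s t ω := by
  unfold pay withTail
  split_ifs with h1 h2 h3
  · rfl
  · rfl
  · have : s = t := le_antisymm (not_lt.1 h2) (not_lt.1 h1)
    subst this
    simp [h3] at hst
  · rfl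

/-- Stop with the probabilities that are optimal in the matrix games with continuation payoff
`limitValue`. -/
def PayoffProcesses.limitStrategy (h : PayoffProcesses P ℱ A B C H) : BehaviorStoppingTime ℱ where
  β k ω := rowOptimal (A k ω) (B k ω) (C k ω) ((P[limitValue P ℱ A B C (k + 1) | ℱ k]) ω)
  adapted k := Measurable.rowOptimal (h.adapted_A k) (h.adapted_B k) (h.adapted_C k)
    stronglyMeasurable_condExp.measurable
  mem_Icc _ _ := ⟨rowOptimal_nonneg .., rowOptimal_le_one ..⟩

/-- Follow `η` before time `m`; from time `m` on stop with probability `δ` whenever the payoff `A`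
is at least `u`. -/
def PayoffProcesses.lateStrategy (h : PayoffProcesses P ℱ A B C H) (η : BehaviorStoppingTime ℱ)
    (m : ℕ) (δ : I) {u : Ω → ℝ} (hu : Measurable[ℱ m] u) : BehaviorStoppingTime ℱ where
  β k ω := if k < m then η.β k ω else if u ω ≤ A k ω then δ else 0
  adapted k := by
    by_cases hk : k < m
    · simpa only [hk, if_true] using η.adapted k
    · simp only [hk, if_false]
      exact Measurable.ite (measurableSet_le (hu.mono (ℱ.mono (not_lt.1 hk)) le_rfl)
        (h.adapted_A k)) measurable_const measurable_const
  mem_Icc k ω := by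
    split_ifs
    exacts [η.mem_Icc k ω, δ.2, by simp]

/-- Stop as `τ` does, except that the game is continued forever when `τ` requires to stop at or after
time `m` for a payoff larger than `u`. -/
def reluctantTime (B : ℕ∞ → Ω → ℝ) (τ : Ω → ℕ∞) (m : ℕ) (u : Ω → ℝ) (ω : Ω) : ℕ∞ :=
  if (m : ℕ∞) ≤ τ ω ∧ u ω < B (τ ω) ω then ⊤ else τ ω

lemma le_reluctantTime (τ : Ω → ℕ∞) (m : ℕ) (u : Ω → ℝ) (ω : Ω) :
    τ ω ≤ reluctantTime B τ m u ω := by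
  unfold reluctantTime
  split_ifs
  · exact le_top
  · exact le_rfl

namespace PayoffProcesses

variable (h : PayoffProcesses P ℱ A B C H)
include h

/-- The threshold `u` is consulted only from time `m` on, when it is already known. -/
lemma isStoppingTime_reluctantTime {τ : Ω → ℕ∞} (hτ : IsStoppingTime ℱ τ) (m : ℕ) {u : Ω → ℝ}
    (hu : Measurable[ℱ m] u) : IsStoppingTime ℱ (reluctantTime B τ m u) := by
  intro n
  have h1 : {ω | reluctantTime B τ m u ω ≤ (n : ℕ∞)} =
      ⋃ k ∈ Finset.range (n + 1), ({ω | (k : ℕ∞) ≤ τ ω} \ {ω | (k : ℕ∞) < τ ω}) ∩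
        {ω | m ≤ k → B k ω ≤ u ω} := by
    ext ω
    simp only [Set.mem_ofPred_eq, Set.mem_iUnion, Finset.mem_range, Set.mem_inter_iff,
      Set.mem_sdiff, exists_prop, not_lt]
    unfold reluctantTime
    constructor
    · intro hle
      split_ifs at hle with hc
      · simp at hle
      · obtain ⟨k, hk⟩ := ENat.ne_top_iff_exists.1 (hle.trans_lt (ENat.natCast_lt_top n)).ne
        rw [← hk] at hle hc
        refine ⟨k, Nat.lt_succ_iff.2 (by exact_mod_cast hle), ⟨hk.le, hk.ge⟩, fun hmk => ?_⟩
        by_contra hlt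
        exact hc ⟨by exact_mod_cast hmk, not_le.1 hlt⟩
    · rintro ⟨k, hk, ⟨hk1, hk2⟩, hB⟩
      have hk3 : τ ω = k := le_antisymm hk2 hk1
      rw [hk3, if_neg]
      · exact_mod_cast Nat.lt_succ_iff.1 hk
      · rintro ⟨hmk, hlt⟩
        exact hlt.not_ge (hB (by exact_mod_cast hmk))
  change MeasurableSet[ℱ n] {ω | reluctantTime B τ m u ω ≤ (n : ℕ∞)}
  rw [h1]
  refine Finset.measurableSet_biUnion _ fun k hk => ?_
  refine ℱ.mono (Nat.lt_succ_iff.1 (Finset.mem_range.1 hk)) _ ?_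
  refine ((measurableSet_le_stoppingTime hτ k).diff (measurableSet_lt_stoppingTime hτ k)).inter ?_
  by_cases hmk : m ≤ k
  · simp only [hmk, true_imp_iff]
    exact measurableSet_le (h.adapted_B k) (hu.mono (ℱ.mono hmk) le_rfl)
  · simp [hmk]

lemma withTail_tailLimit : PayoffProcesses P ℱ A B (withTail C (tailLimit A C)) H where
  adapted_A := h.adapted_A
  adapted_B := h.adapted_B
  adapted_C n := by
    have : withTail C (tailLimit A C) n = C n := by ext; simp [withTail]
    rw [this]
    exact h.adapted_C n
  measurable_A_top := h.measurable_A_top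
  measurable_B_top := h.measurable_B_top
  measurable_C_top := by
    have : withTail C (tailLimit A C) ⊤ = tailLimit A C := by ext; simp [withTail]
    rw [this]
    exact h.measurable_tailLimit
  integrable := h.integrable
  bound := by
    filter_upwards [h.bound] with ω hω n
    refine ⟨(hω n).1, (hω n).2.1, ?_⟩
    unfold withTail
    split_ifs
    · exact abs_tailLimit_le (fun n => (hω n).1) (hω ⊤).2.2
    · exact (hω n).2.2

variable [IsFiniteMeasure P] [IsProbabilityMeasure Q]

/-- In the game in which never stopping yields `tailLimit`, the maximizer guarantees the limit of the
values of the truncated games. -/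
lemma integral_limitValue_le {N : R × Ω → ℕ∞} {τ : Ω → ℕ∞}
    (hN : Realizes Q N h.limitStrategy.β) (hτ : IsStoppingTime ℱ τ) :
    ∫ ω, limitValue P ℱ A B C 0 ω ∂P ≤
      ∫ z, pay A B (withTail C (tailLimit A C)) (N z) (τ z.2) z.2 ∂(Q.prod P) := by
  have hτm : Measurable fun z : R × Ω => τ z.2 := (measurable_stoppingTime hτ).comp measurable_snd
  have h1 (T : ℕ) : ∫ ω, limitValue P ℱ A B C 0 ω ∂P ≤
      ∫ z, stopped A B C T (tailMax A C T) (N z) (τ z.2) z.2 ∂(Q.prod P) := by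
    refine (h.integral_le_integral_stopped hN hτ T (fun n _ => h.integrable_limitValue n)
      (fun n _ => ?_) (fun n _ => ?_)).trans (h.integral_stopped_le_of_le_condExp hN hτ T
        (h.integrable_limitValue T) (h.integrable_tailMax T) (h.limitValue_le_condExp T))
    · filter_upwards [h.limitValue_le_matrixValue n] with ω hω
      exact hω.trans (matrixValue_le_rowOptimal _ _ _ _).1
    · filter_upwards [h.limitValue_le_matrixValue n] with ω hω
      exact hω.trans (matrixValue_le_rowOptimal _ _ _ _).2
  -- As `T → ∞` the terminal payoff matters only on paths where nobody ever stops, and there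
  -- `tailMax` tends to `tailLimit`.
  refine ge_of_tendsto' (x := atTop) ?_ h1
  refine tendsto_integral_of_dominated_convergence (fun z => H z.2)
    (fun n => (h.integrable_stopped hN.measurable hτm n (h.integrable_tailMax n)).1)
    (h.integrable.comp_snd Q) (fun n => ?_) ?_
  · filter_upwards [h.ae_bound Q] with z hz
    rw [stopped]
    split_ifs
    · exact abs_pay_le hz _ _
    · exact abs_tailMax_le (fun n => (hz n).1) (hz ⊤).2.2 n
  · filter_upwards [h.ae_bound Q] with z hz
    by_cases htop : min (N z) (τ z.2) = ⊤
    · obtain ⟨e1, e2⟩ := min_eq_top.1 htop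
      have e3 (n : ℕ) : ¬((⊤ : ℕ∞) < n) := not_top_lt
      simp only [stopped, pay, e1, e2, withTail, min_self, e3, if_false, lt_irrefl, if_true]
      exact tendsto_tailMax (fun n => (hz n).1) (hz ⊤).2.2
    · obtain ⟨k, hk⟩ := ENat.ne_top_iff_exists.1 htop
      refine tendsto_const_nhds.congr' ?_
      filter_upwards [eventually_gt_atTop k] with n hn
      rw [stopped, if_pos, pay_withTail (lt_top_iff_ne_top.2 htop)]
      rw [← hk]
      exact_mod_cast hn

omit h [IsFiniteMeasure P] [IsProbabilityMeasure Q] in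
/-- Pointwise comparison of the two games. -/
lemma pay_withTail_le {ω : Ω} (hω : ∀ n, |A n ω| ≤ H ω ∧ |B n ω| ≤ H ω ∧ |C n ω| ≤ H ω)
    {N N' : ℕ∞} {τ : Ω → ℕ∞} {m : ℕ} {u : Ω → ℝ} {ε : ℝ} (hε : 0 < ε)
    (heq : N < m → N' = N) (hle : (m : ℕ∞) ≤ N → (m : ℕ∞) ≤ N')
    (hcol : ∀ n : ℕ, m ≤ n → N' = n → u ω - ε ≤ A n ω)
    (hnever : N' = ⊤ → ¬∃ᶠ n : ℕ in atTop, u ω - ε ≤ A n ω) :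
    pay A B (withTail C (tailLimit A C)) N (reluctantTime B τ m u ω) ω ≤
      pay A B C N' (τ ω) ω + (ε + |tailLimit A C ω - u ω| +
        (if (m : ℕ∞) ≤ N ∧ N < ⊤ then 2 * H ω else 0) +
        (if N' = τ ω ∧ (m : ℕ∞) ≤ τ ω ∧ τ ω < ⊤ then 2 * H ω else 0) +
        (if ε ≤ |tailLimit A C ω - u ω| then 2 * H ω else 0)) := by
  have hA := fun n => (hω n).1
  have hC := (hω ⊤).2.2
  have hL := abs_tailLimit_le hA hC
  have hH : 0 ≤ H ω := (abs_nonneg _).trans hC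
  have hω' : ∀ n, |A n ω| ≤ H ω ∧ |B n ω| ≤ H ω ∧ |withTail C (tailLimit A C) n ω| ≤ H ω := by
    refine fun n => ⟨(hω n).1, (hω n).2.1, ?_⟩
    unfold withTail
    split_ifs
    exacts [hL, (hω n).2.2]
  have hpay := abs_le.1 (abs_pay_le hω N' (τ ω))
  have hpay' := abs_le.1 (abs_pay_le hω' N (reluctantTime B τ m u ω))
  have habs := le_abs_self (tailLimit A C ω - u ω)
  have habs0 := abs_nonneg (tailLimit A C ω - u ω)
  have n1 : 0 ≤ if (m : ℕ∞) ≤ N ∧ N < ⊤ then 2 * H ω else 0 := by split_ifs <;> linarith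
  have n2 : 0 ≤ if N' = τ ω ∧ (m : ℕ∞) ≤ τ ω ∧ τ ω < ⊤ then 2 * H ω else 0 := by
    split_ifs <;> linarith
  have n3 : 0 ≤ if ε ≤ |tailLimit A C ω - u ω| then 2 * H ω else 0 := by split_ifs <;> linarith
  -- If one of the players stops before `m`, both games pay the same. A finite `N ≥ m` is charged to
  -- the error term for late stopping, both payoffs being within `H`. There remains `N = ⊤`.
  rcases lt_or_ge (τ ω) m with hτm | hτm
  · have e1 : reluctantTime B τ m u ω = τ ω := if_neg fun hc => hc.1.not_gt hτm
    have e2 : pay A B (withTail C (tailLimit A C)) N (reluctantTime B τ m u ω) ω =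
        pay A B C N' (τ ω) ω := by
      rw [e1, pay_withTail ((min_le_right _ _).trans_lt (hτm.trans_le le_top))]
      rcases lt_or_ge N m with hN | hN
      · rw [heq hN]
      · have l1 := hτm.trans_le hN
        have l2 := hτm.trans_le (hle hN)
        simp [pay, l1, l2, l1.not_gt, l2.not_gt]
    linarith
  rcases lt_or_ge N m with hN | hN
  · have l1 := hN.trans_le hτm
    have l2 := l1.trans_le (le_reluctantTime (B := B) τ m u ω)
    have e2 : pay A B (withTail C (tailLimit A C)) N (reluctantTime B τ m u ω) ω =
        pay A B C N' (τ ω) ω := by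
      rw [heq hN]
      simp [pay, l1, l2]
    linarith
  rcases lt_or_eq_of_le (le_top (a := N)) with hNtop | hNtop
  · rw [if_pos ⟨hN, hNtop⟩]
    linarith
  have hN' := hle hN
  subst hNtop
  -- Against `N = ⊤` the reluctant opponent pays either `tailLimit`, when `B` exceeds `u` or he
  -- never stops, or a `B` that is at most `u`. Hence both bounds, up to the distance between
  -- `tailLimit` and `u`.
  have hb : pay A B (withTail C (tailLimit A C)) ⊤ (reluctantTime B τ m u ω) ω ≤
      u ω + |tailLimit A C ω - u ω| ∧ (τ ω < ⊤ →
      pay A B (withTail C (tailLimit A C)) ⊤ (reluctantTime B τ m u ω) ω ≤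
      B (τ ω) ω + |tailLimit A C ω - u ω|) := by
    by_cases hc : (m : ℕ∞) ≤ τ ω ∧ u ω < B (τ ω) ω
    · have e1 : reluctantTime B τ m u ω = ⊤ := if_pos hc
      have e2 : pay A B (withTail C (tailLimit A C)) ⊤ (reluctantTime B τ m u ω) ω =
          tailLimit A C ω := by simp [e1, pay, withTail]
      rw [e2]
      exact ⟨by linarith, fun _ => by linarith [hc.2]⟩
    · have e1 : reluctantTime B τ m u ω = τ ω := if_neg hc
      have hc' : B (τ ω) ω ≤ u ω := not_lt.1 fun hlt => hc ⟨hτm, hlt⟩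
      rw [e1]
      rcases lt_or_eq_of_le (le_top (a := τ ω)) with ht | ht
      · have e2 : pay A B (withTail C (tailLimit A C)) ⊤ (τ ω) ω = B (τ ω) ω := by
          simp [pay, ht]
        rw [e2]
        exact ⟨by linarith, fun _ => by linarith⟩
      · have e2 : pay A B (withTail C (tailLimit A C)) ⊤ (τ ω) ω = tailLimit A C ω := by
          simp [ht, pay, withTail]
        rw [e2]
        exact ⟨by linarith, fun hlt => absurd ht hlt.ne⟩
  rcases lt_trichotomy N' (τ ω) with hlt | heqτ | hgt
  · obtain ⟨n, hn⟩ := ENat.ne_top_iff_exists.1 (hlt.trans_le le_top).ne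
    have hmn : m ≤ n := by
      rw [← hn] at hN'
      exact_mod_cast hN'
    have e1 : pay A B C N' (τ ω) ω = A n ω := by rw [pay, if_pos hlt, hn]
    have := hcol n hmn hn.symm
    rw [e1]
    linarith [hb.1]
  · rcases lt_or_eq_of_le (le_top (a := τ ω)) with ht | ht
    · rw [if_pos (c := N' = τ ω ∧ (m : ℕ∞) ≤ τ ω ∧ τ ω < ⊤) ⟨heqτ, hτm, ht⟩]
      linarith
    · by_cases hd : ε ≤ |tailLimit A C ω - u ω|
      · rw [if_pos hd]
        linarith
      · have e1 : pay A B C N' (τ ω) ω = C ⊤ ω := by simp [pay, heqτ, ht]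
        have e2 : pay A B (withTail C (tailLimit A C)) ⊤ (reluctantTime B τ m u ω) ω =
            tailLimit A C ω := by
          have : reluctantTime B τ m u ω = ⊤ :=
            top_le_iff.1 (ht ▸ le_reluctantTime (B := B) τ m u ω)
          simp [this, pay, withTail]
        -- Nobody stops in the true game. Payoffs `A ≥ u - ε` cannot then recur, by `hnever`, and
        -- since `u - ε < tailLimit` this leaves only `tailLimit ≤ C ⊤`.
        rcases tailLimit_le_or_frequently hA hC with h1 | h1
        · rw [e1, e2]
          linarith
        · exact absurd (h1 (u ω - ε) (by linarith [(abs_lt.1 (not_le.1 hd)).1]))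
            (hnever (heqτ.trans ht))
  · have e1 : pay A B C N' (τ ω) ω = B (τ ω) ω := by simp [pay, hgt, hgt.not_gt]
    rw [e1]
    linarith [hb.2 (hgt.trans_le le_top)]

end PayoffProcesses

end

/-! ### Vanishing error terms and the guarantee of the maximizer -/

section

variable {Ω : Type*} {mΩ : MeasurableSpace Ω} {P : Measure Ω} {ℱ : Filtration ℕ mΩ}
  {A B C : ℕ∞ → Ω → ℝ} {H : Ω → ℝ} {R : Type*} [MeasurableSpace R] {Q : Measure R}

lemma integrable_ite {α : Type*} {mα : MeasurableSpace α} {μ : Measure α} {f : α → ℝ}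
    (hf : Integrable f μ) {p : α → Prop} [DecidablePred p] (hp : MeasurableSet {z | p z}) :
    Integrable (fun z => if p z then f z else 0) μ :=
  (hf.indicator hp).congr (Eventually.of_forall fun z => by simp [Set.indicator])

namespace PayoffProcesses

variable (h : PayoffProcesses P ℱ A B C H) [IsFiniteMeasure P]
include h

omit [IsFiniteMeasure P] in
lemma ae_nonneg : ∀ᵐ ω ∂P, 0 ≤ H ω := by
  filter_upwards [h.bound] with ω hω using (abs_nonneg _).trans (hω ⊤).1

/-- Lévy's upward theorem in L¹: `tailLimit` is measurable for the σ-algebra generated by the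
filtration. -/
lemma tendsto_integral_abs_sub_condExp (hℱ : ⨆ n, ℱ n = mΩ) :
    Tendsto (fun m => ∫ ω, |tailLimit A C ω - (P[tailLimit A C | ℱ m]) ω| ∂P) atTop (𝓝 0) := by
  have h1 := h.integrable_tailLimit.tendsto_eLpNorm_condExp (ℱ := ℱ)
    (by rw [hℱ]; exact h.measurable_tailLimit.stronglyMeasurable)
  have h2 := (ENNReal.tendsto_toReal ENNReal.zero_ne_top).comp h1
  refine h2.congr fun m => ?_
  rw [Function.comp_apply, eLpNorm_one_eq_lintegral_enorm,
    ← integral_norm_eq_lintegral_enorm (integrable_condExp.sub h.integrable_tailLimit).1]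
  refine integral_congr_ae (Eventually.of_forall fun ω => ?_)
  simp only [Pi.sub_apply, Real.norm_eq_abs]
  exact abs_sub_comm _ _

lemma tendsto_integral_deviation (hℱ : ⨆ n, ℱ n = mΩ) {ε : ℝ} (hε : 0 < ε) :
    Tendsto (fun m => ∫ ω, (if ε ≤ |tailLimit A C ω - (P[tailLimit A C | ℱ m]) ω|
      then 2 * H ω else 0) ∂P) atTop (𝓝 0) := by
  have h1 := h.integrable_tailLimit.tendsto_ae_condExp (ℱ := ℱ)
    (by rw [hℱ]; exact h.measurable_tailLimit.stronglyMeasurable)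
  rw [show 𝓝 (0 : ℝ) = 𝓝 (∫ _, (0 : ℝ) ∂P) by rw [integral_zero]]
  refine tendsto_integral_of_dominated_convergence (fun ω => 2 * H ω) (fun m => ?_)
    (h.integrable.const_mul 2) (fun m => ?_) ?_
  · have hm : MeasurableSet {ω | ε ≤ |tailLimit A C ω - (P[tailLimit A C | ℱ m]) ω|} :=
      measurableSet_le measurable_const (h.measurable_tailLimit.sub
        (stronglyMeasurable_condExp.measurable.mono (ℱ.le m) le_rfl)).abs
    exact (integrable_ite (h.integrable.const_mul 2) hm).1
  · filter_upwards [h.ae_nonneg] with ω hω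
    split_ifs
    · rw [Real.norm_of_nonneg (by linarith)]
    · simpa using hω
  · filter_upwards [h1] with ω hω
    refine tendsto_const_nhds.congr' ?_
    have h2 : Tendsto (fun m => |tailLimit A C ω - (P[tailLimit A C | ℱ m]) ω|) atTop (𝓝 0) := by
      simpa using (hω.const_sub (tailLimit A C ω)).abs
    filter_upwards [h2.eventually (gt_mem_nhds hε)] with m hm
    rw [if_neg hm.not_ge]

variable [IsProbabilityMeasure Q]

/-- For a fixed random time, the events of stopping at a finite time not before `m` decrease to the
empty set. -/
lemma tendsto_integral_late {N : R × Ω → ℕ∞} (hN : Measurable N) :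
    Tendsto (fun m : ℕ => ∫ z, (if (m : ℕ∞) ≤ N z ∧ N z < ⊤ then 2 * H z.2 else 0) ∂(Q.prod P))
      atTop (𝓝 0) := by
  have hH := (h.integrable.comp_snd Q).const_mul 2
  rw [show 𝓝 (0 : ℝ) = 𝓝 (∫ _, (0 : ℝ) ∂(Q.prod P)) by rw [integral_zero]]
  refine tendsto_integral_of_dominated_convergence (fun z => 2 * H z.2) (fun m => ?_)
    hH (fun m => ?_) ?_
  · have hm : MeasurableSet {z | (m : ℕ∞) ≤ N z ∧ N z < ⊤} :=
      hN (MeasurableSet.of_discrete (s := {s : ℕ∞ | (m : ℕ∞) ≤ s ∧ s < ⊤}))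
    exact (integrable_ite hH hm).1
  · filter_upwards [Measure.quasiMeasurePreserving_snd.ae h.ae_nonneg] with z hz
    split_ifs
    · rw [Real.norm_of_nonneg (by linarith)]
    · simpa using hz
  · refine Eventually.of_forall fun z => tendsto_const_nhds.congr' ?_
    by_cases htop : N z = ⊤
    · simp [htop]
    · obtain ⟨k, hk⟩ := ENat.ne_top_iff_exists.1 htop
      filter_upwards [eventually_gt_atTop k] with m hm
      rw [if_neg]
      rintro ⟨hle, -⟩
      rw [← hk] at hle
      exact hm.not_ge (by exact_mod_cast hle)

omit h [IsFiniteMeasure P] in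
lemma measurableSet_simultaneous {N : R × Ω → ℕ∞} (hN : Measurable N) {τ : Ω → ℕ∞}
    (hτ : Measurable τ) (m : ℕ) :
    MeasurableSet {z : R × Ω | N z = τ z.2 ∧ (m : ℕ∞) ≤ τ z.2 ∧ τ z.2 < ⊤} :=
  (hN.prodMk (hτ.comp measurable_snd))
    (MeasurableSet.of_discrete (s := {p : ℕ∞ × ℕ∞ | p.1 = p.2 ∧ (m : ℕ∞) ≤ p.2 ∧ p.2 < ⊤}))

lemma integrable_simultaneous {N : R × Ω → ℕ∞} (hN : Measurable N) {τ : Ω → ℕ∞}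
    (hτ : Measurable τ) (m : ℕ) :
    Integrable (fun z : R × Ω => if N z = τ z.2 ∧ (m : ℕ∞) ≤ τ z.2 ∧ τ z.2 < ⊤ then 2 * H z.2
      else 0) (Q.prod P) :=
  integrable_ite ((h.integrable.comp_snd Q).const_mul 2) (measurableSet_simultaneous hN hτ m)

/-- Given ω the time `τ` is a fixed number `n`, and the draw hits it with probability `survival * β
n ≤ δ`. The bound is uniform in `τ`. -/
lemma integral_simultaneous_le {N : R × Ω → ℕ∞} {η : BehaviorStoppingTime ℱ}
    (hN : Realizes Q N η.β) {τ : Ω → ℕ∞} (hτ : Measurable τ) {m : ℕ} {δ : ℝ}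
    (hδ : ∀ n ω, m ≤ n → η.β n ω ≤ δ) :
    ∫ z, (if N z = τ z.2 ∧ (m : ℕ∞) ≤ τ z.2 ∧ τ z.2 < ⊤ then 2 * H z.2 else 0) ∂(Q.prod P) ≤
      2 * δ * ∫ ω, H ω ∂P := by
  have hi := h.integrable_simultaneous (Q := Q) hN.measurable hτ m
  rw [integral_prod_symm _ hi, ← integral_const_mul]
  refine integral_mono_ae hi.integral_prod_right (h.integrable.const_mul _) ?_
  filter_upwards [h.ae_nonneg] with ω hω
  by_cases hc : (m : ℕ∞) ≤ τ ω ∧ τ ω < ⊤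
  · obtain ⟨n, hn⟩ := ENat.ne_top_iff_exists.1 hc.2.ne
    have hmn : m ≤ n := by
      have := hc.1
      rw [← hn] at this
      exact_mod_cast this
    have h1 (r : R) : (if N (r, ω) = τ ω ∧ (m : ℕ∞) ≤ τ ω ∧ τ ω < ⊤ then 2 * H ω else 0) =
        {r | N (r, ω) = n}.indicator (fun _ => 2 * H ω) r := by
      rw [← hn] at hc ⊢
      simp only [hc, and_true, Set.indicator, Set.mem_ofPred_eq]
    have h2 : MeasurableSet {r | N (r, ω) = n} :=
      hN.measurable_section ω (MeasurableSet.of_discrete (s := {(n : ℕ∞)}))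
    simp_rw [h1]
    rw [integral_indicator_const _ h2, hN.measureReal_eq, smul_eq_mul]
    have h3 : survival η.β n ω * η.β n ω ≤ δ :=
      (mul_le_of_le_one_left (η.mem_Icc n ω).1 (η.survival_le_one n ω)).trans (hδ n ω hmn)
    nlinarith
  · have hδ0 : 0 ≤ δ := (η.mem_Icc m ω).1.trans (hδ m ω le_rfl)
    simp only [hc, and_false, if_false, integral_zero]
    positivity

/-- The maximizer guarantees the limit of the values of the truncated games up to `e`. -/
theorem exists_maximizer_guarantee (hℱ : ⨆ n, ℱ n = mΩ) {e : ℝ} (he : 0 < e) :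
    ∃ η : BehaviorStoppingTime ℱ, ∀ τ : Ω → ℕ∞, IsStoppingTime ℱ τ →
      ∫ ω, limitValue P ℱ A B C 0 ω ∂P - e ≤ ∫ z, pay A B C (η.time z) (τ z.2) z.2
        ∂((Measure.infinitePi fun _ : ℕ => (volume : Measure I)).prod P) := by
  set Q := Measure.infinitePi fun _ : ℕ => (volume : Measure I)
  set p := P.real Set.univ
  have hp : 0 ≤ p := measureReal_nonneg
  -- Five error terms are each allotted `e / 5`: the slack `ε`, the distance from `tailLimit` to
  -- `u`, late stopping of the original strategy, simultaneous stopping, and a large deviation of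
  -- `u`. The `+ 1` here and in `d` prevents division by zero.
  set ε := e / 5 / (p + 1) with hεdef
  have hε : 0 < ε := by positivity
  have hεp : ε * p ≤ e / 5 := by
    rw [hεdef, div_mul_eq_mul_div, div_le_iff₀ (by positivity)]
    nlinarith
  have hHi : 0 ≤ ∫ ω, H ω ∂P := integral_nonneg_of_ae h.ae_nonneg
  obtain ⟨δ, hδ0, hδ⟩ : ∃ δ : I, 0 < (δ : ℝ) ∧ 2 * δ * ∫ ω, H ω ∂P ≤ e / 5 := by
    set d := e / 5 / (2 * ∫ ω, H ω ∂P + 1) with hd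
    have hd0 : 0 < d := by positivity
    refine ⟨⟨min 1 d, le_min zero_le_one hd0.le, min_le_left _ _⟩, lt_min one_pos hd0, ?_⟩
    have h1 : d * (2 * ∫ ω, H ω ∂P + 1) = e / 5 := by rw [hd]; field_simp
    have h2 : min 1 d * (2 * ∫ ω, H ω ∂P) ≤ d * (2 * ∫ ω, H ω ∂P) :=
      mul_le_mul_of_nonneg_right (min_le_right _ _) (by positivity)
    change 2 * min 1 d * _ ≤ _
    linarith
  set η := h.limitStrategy
  have hN : Realizes Q η.time η.β := η.realizes_time
  have he5 : 0 < e / 5 := by positivity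
  -- The time `m` depends on `ε` and the stage strategy `η` but not on `τ`, so the strategy built
  -- from it works against every opponent.
  obtain ⟨m, h1, h2, h3⟩ := (((h.tendsto_integral_abs_sub_condExp hℱ).eventually
    (gt_mem_nhds he5)).and (((h.tendsto_integral_deviation hℱ hε).eventually
    (gt_mem_nhds he5)).and ((h.tendsto_integral_late (Q := Q) hN.measurable).eventually
    (gt_mem_nhds he5)))).exists
  set L := tailLimit A C
  set u : Ω → ℝ := P[L | ℱ m] with hu
  have hum : Measurable[ℱ m] u := stronglyMeasurable_condExp.measurable
  set η' := h.lateStrategy η m δ (u := fun ω => u ω - ε) (hum.sub measurable_const)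
  have hη : ∀ k < m, η.β k = η'.β k := fun k hk => by
    ext ω
    exact (if_pos hk).symm
  have hη' (k : ℕ) (ω : Ω) (hk : m ≤ k) : η'.β k ω = if u ω - ε ≤ A k ω then (δ : ℝ) else 0 :=
    if_neg hk.not_gt
  have hN' : Realizes Q η'.time η'.β := η'.realizes_time
  refine ⟨η', fun τ hτ => ?_⟩
  have hτm := measurable_stoppingTime hτ
  have hτm' : Measurable fun z : (ℕ → I) × Ω => τ z.2 := hτm.comp measurable_snd
  have hσ := h.isStoppingTime_reluctantTime hτ m hum
  have hσm : Measurable fun z : (ℕ → I) × Ω => reluctantTime B τ m u z.2 :=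
    (measurable_stoppingTime hσ).comp measurable_snd
  have i0 := h.integrable_pay (Q := Q) hN'.measurable hτm'
  have i1' : Integrable (fun ω => |L ω - u ω|) P :=
    (h.integrable_tailLimit.sub integrable_condExp).abs
  have i1 : Integrable (fun z : (ℕ → I) × Ω => ε + |L z.2 - u z.2|) (Q.prod P) :=
    (integrable_const ε).add (i1'.comp_snd Q)
  have hH := (h.integrable.comp_snd Q).const_mul 2
  have i2 : Integrable (fun z : (ℕ → I) × Ω => if (m : ℕ∞) ≤ η.time z ∧ η.time z < ⊤
      then 2 * H z.2 else 0) (Q.prod P) :=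
    integrable_ite hH
      (hN.measurable (MeasurableSet.of_discrete (s := {s : ℕ∞ | (m : ℕ∞) ≤ s ∧ s < ⊤})))
  have i3 := h.integrable_simultaneous (Q := Q) hN'.measurable hτm m
  have hdev : MeasurableSet {ω | ε ≤ |L ω - u ω|} :=
    measurableSet_le measurable_const (h.measurable_tailLimit.sub (hum.mono (ℱ.le m) le_rfl)).abs
  have i4' : Integrable (fun ω => if ε ≤ |L ω - u ω| then 2 * H ω else 0) P :=
    integrable_ite (h.integrable.const_mul 2) hdev
  have i4 : Integrable (fun z : (ℕ → I) × Ω => if ε ≤ |L z.2 - u z.2| then 2 * H z.2 else 0)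
      (Q.prod P) := i4'.comp_snd Q
  have i12 : Integrable (fun z : (ℕ → I) × Ω => ε + |L z.2 - u z.2| +
    (if (m : ℕ∞) ≤ η.time z ∧ η.time z < ⊤ then 2 * H z.2 else 0)) (Q.prod P) := i1.add i2
  have i123 : Integrable (fun z : (ℕ → I) × Ω => ε + |L z.2 - u z.2| +
    (if (m : ℕ∞) ≤ η.time z ∧ η.time z < ⊤ then 2 * H z.2 else 0) +
    (if η'.time z = τ z.2 ∧ (m : ℕ∞) ≤ τ z.2 ∧ τ z.2 < ⊤ then 2 * H z.2 else 0)) (Q.prod P) :=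
    i12.add i3
  have i1234 : Integrable (fun z : (ℕ → I) × Ω => ε + |L z.2 - u z.2| +
    (if (m : ℕ∞) ≤ η.time z ∧ η.time z < ⊤ then 2 * H z.2 else 0) +
    (if η'.time z = τ z.2 ∧ (m : ℕ∞) ≤ τ z.2 ∧ τ z.2 < ⊤ then 2 * H z.2 else 0) +
    (if ε ≤ |L z.2 - u z.2| then 2 * H z.2 else 0)) (Q.prod P) := i123.add i4
  have hmain : ∫ ω, limitValue P ℱ A B C 0 ω ∂P ≤
      ∫ z, (pay A B C (η'.time z) (τ z.2) z.2 + (ε + |L z.2 - u z.2| +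
        (if (m : ℕ∞) ≤ η.time z ∧ η.time z < ⊤ then 2 * H z.2 else 0) +
        (if η'.time z = τ z.2 ∧ (m : ℕ∞) ≤ τ z.2 ∧ τ z.2 < ⊤ then 2 * H z.2 else 0) +
        (if ε ≤ |L z.2 - u z.2| then 2 * H z.2 else 0))) ∂(Q.prod P) := by
    refine (h.integral_limitValue_le hN hσ).trans (integral_mono_ae
      (h.withTail_tailLimit.integrable_pay hN.measurable hσm) (i0.add i1234) ?_)
    filter_upwards [h.ae_bound Q, hN'.ae_ne_zero (P := P), hN'.ae_not_frequently (P := P) hδ0]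
      with z hz hz1 hz2
    refine pay_withTail_le hz hε (BehaviorStoppingTime.time_eq_of_lt hη)
      (BehaviorStoppingTime.le_time_of_le hη) (fun n hmn hn => ?_) (fun htop hfreq => ?_)
    · have := hz1 n hn
      rw [hη' n _ hmn] at this
      by_contra hlt
      exact this (if_neg hlt)
    · refine hz2 htop ((hfreq.and_eventually (eventually_ge_atTop m)).mono fun n hn => ?_)
      rw [hη' n _ hn.2, if_pos hn.1]
  rw [integral_add i0 i1234, integral_add i123 i4, integral_add i12 i3, integral_add i1 i2] at hmain
  have e1 : ∫ z : (ℕ → I) × Ω, (ε + |L z.2 - u z.2|) ∂(Q.prod P) ≤ e / 5 + e / 5 := by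
    rw [integral_fun_snd (μ := Q) (ν := P) (fun ω => ε + |L ω - u ω|), integral_add
      (integrable_const ε) i1', integral_const]
    simp only [probReal_univ, smul_eq_mul]
    linarith
  have e3 := h.integral_simultaneous_le hN' hτm (m := m) (δ := δ) (fun n ω hn => by
    rw [hη' n ω hn]
    split_ifs
    exacts [le_rfl, hδ0.le])
  have e4 : ∫ z : (ℕ → I) × Ω, (if ε ≤ |L z.2 - u z.2| then 2 * H z.2 else 0) ∂(Q.prod P) ≤
      e / 5 := by
    rw [integral_fun_snd (μ := Q) (ν := P) (fun ω => if ε ≤ |L ω - u ω| then 2 * H ω else 0)]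
    simp only [probReal_univ, one_smul]
    exact h2.le
  linarith

end PayoffProcesses

end

section

variable {Ω : Type*} {mΩ : MeasurableSpace Ω} {P : Measure Ω} {ℱ : Filtration ℕ mΩ}
  {A B C : ℕ∞ → Ω → ℝ} {H : Ω → ℝ} {R : Type*} [MeasurableSpace R] {Q : Measure R}

/-! Equivalence of random times with the same conditional probabilities of stopping -/

/-- A finite law on `ℕ∞` is determined by its tails `Set.Ici n`: finite points by differences, `⊤`
by continuity from above. -/
lemma Realizes.map_eq {R' : Type*} [MeasurableSpace R'] {Q' : Measure R'} [IsFiniteMeasure Q]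
    [IsFiniteMeasure Q'] {N : R × Ω → ℕ∞} {N' : R' × Ω → ℕ∞} {x : ℕ → Ω → ℝ}
    (hN : Realizes Q N x) (hN' : Realizes Q' N' x) (ω : Ω) :
    Q.map (fun r => N (r, ω)) = Q'.map fun r => N' (r, ω) := by
  have hIci (n : ℕ) : Q.map (fun r => N (r, ω)) (Set.Ici (n : ℕ∞)) =
      Q'.map (fun r => N' (r, ω)) (Set.Ici (n : ℕ∞)) := by
    rw [Measure.map_apply (hN.measurable_section ω) .of_discrete,
      Measure.map_apply (hN'.measurable_section ω) .of_discrete]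
    exact (hN.measure_le ω n).trans (hN'.measure_le ω n).symm
  refine Measure.ext_of_singleton fun s => ?_
  induction s with
  | top =>
    have h1 : ({⊤} : Set ℕ∞) = ⋂ n : ℕ, Set.Ici (n : ℕ∞) := by
      ext s
      simp only [Set.mem_singleton_iff, Set.mem_iInter, Set.mem_Ici]
      exact ⟨fun h n => h ▸ le_top, fun h => ENat.eq_top_iff_forall_ge.2 h⟩
    have hanti : Antitone fun n : ℕ => Set.Ici (n : ℕ∞) :=
      fun m n hmn => Set.Ici_subset_Ici.2 (Nat.cast_le.2 hmn)
    rw [h1]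
    have t1 := tendsto_measure_iInter_atTop (μ := Q.map fun r => N (r, ω))
      (fun n => MeasurableSet.of_discrete.nullMeasurableSet) hanti ⟨0, measure_ne_top _ _⟩
    have t2 := tendsto_measure_iInter_atTop (μ := Q'.map fun r => N' (r, ω))
      (fun n => MeasurableSet.of_discrete.nullMeasurableSet) hanti ⟨0, measure_ne_top _ _⟩
    exact tendsto_nhds_unique t1 (t2.congr fun n => (hIci n).symm)
  | coe n =>
    have h1 : ({(n : ℕ∞)} : Set ℕ∞) = Set.Ici (n : ℕ∞) \ Set.Ici ((n + 1 : ℕ) : ℕ∞) := by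
      ext s
      exact eq_natCast_iff s n
    have h2 : Set.Ici ((n + 1 : ℕ) : ℕ∞) ⊆ Set.Ici (n : ℕ∞) :=
      Set.Ici_subset_Ici.2 (Nat.cast_le.2 n.le_succ)
    rw [h1, measure_sdiff h2 MeasurableSet.of_discrete.nullMeasurableSet (measure_ne_top _ _),
      measure_sdiff h2 MeasurableSet.of_discrete.nullMeasurableSet (measure_ne_top _ _), hIci, hIci]

/-- For fixed ω the payoff is a function of the random time alone, because `τ` does not involve the
draw; only the conditional law matters. This transfers guarantees between classes. -/
lemma PayoffProcesses.integral_pay_congr (h : PayoffProcesses P ℱ A B C H) [IsFiniteMeasure P]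
    {R' : Type*} [MeasurableSpace R'] {Q' : Measure R'} [IsProbabilityMeasure Q]
    [IsProbabilityMeasure Q'] {N : R × Ω → ℕ∞} {N' : R' × Ω → ℕ∞} {x : ℕ → Ω → ℝ}
    (hN : Realizes Q N x) (hN' : Realizes Q' N' x) {τ : Ω → ℕ∞} (hτ : Measurable τ) :
    ∫ z, pay A B C (N z) (τ z.2) z.2 ∂(Q.prod P) =
      ∫ z, pay A B C (N' z) (τ z.2) z.2 ∂(Q'.prod P) := by
  rw [integral_prod_symm _ (h.integrable_pay (t := fun z => τ z.2) hN.measurable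
      (hτ.comp measurable_snd)),
    integral_prod_symm _ (h.integrable_pay (t := fun z => τ z.2) hN'.measurable
      (hτ.comp measurable_snd))]
  refine integral_congr_ae (Eventually.of_forall fun ω => ?_)
  have e1 := integral_map (μ := Q) (hN.measurable_section ω).aemeasurable
    (f := fun s => pay A B C s (τ ω) ω) Measurable.of_discrete.aestronglyMeasurable
  have e2 := integral_map (μ := Q') (hN'.measurable_section ω).aemeasurable
    (f := fun s => pay A B C s (τ ω) ω) Measurable.of_discrete.aestronglyMeasurable
  rw [hN.map_eq hN' ω] at e1
  exact e1.symm.trans e2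

/-! Randomized stopping times -/

namespace RandomizedStoppingTime

variable (η : RandomizedStoppingTime ℱ)

lemma natCast_le_time_iff (z : I × Ω) (n : ℕ) :
    (n : ℕ∞) ≤ η.time z ↔ ∀ k < n, ∑ i ∈ Finset.range (k + 1), η.ρ i z.2 < z.1 := by
  rw [time, natCast_le_iInf_iff]
  simp

lemma measurable_sum {k n : ℕ} (hk : k ≤ n) :
    Measurable[ℱ n] fun ω => ∑ i ∈ Finset.range (k + 1), η.ρ i ω :=
  Finset.measurable_fun_sum _ fun i hi => (η.adapted.1 i).mono
    (ℱ.mono ((Nat.lt_succ_iff.1 (Finset.mem_range.1 hi)).trans hk)) le_rfl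

lemma isStoppingTime_time (r : I) : IsStoppingTime ℱ fun ω => η.time (r, ω) := by
  refine isStoppingTime_of_measurableSet_le fun n => ?_
  simp only [natCast_le_time_iff]
  have : {ω | ∀ k < n + 1, ∑ i ∈ Finset.range (k + 1), η.ρ i ω < (r : ℝ)} =
      ⋂ k ∈ Finset.range (n + 1), {ω | ∑ i ∈ Finset.range (k + 1), η.ρ i ω < (r : ℝ)} := by
    ext; simp
  rw [this]
  exact Finset.measurableSet_biInter _ fun k hk =>
    η.measurable_sum (Nat.lt_succ_iff.1 (Finset.mem_range.1 hk)) measurableSet_Iio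

lemma measurable_time : Measurable η.time := by
  refine measurable_of_measurableSet_le fun n => ?_
  simp only [natCast_le_time_iff]
  have : {z : I × Ω | ∀ k < n, ∑ i ∈ Finset.range (k + 1), η.ρ i z.2 < (z.1 : ℝ)} =
      ⋂ k ∈ Finset.range n, {z | ∑ i ∈ Finset.range (k + 1), η.ρ i z.2 < (z.1 : ℝ)} := by
    ext; simp
  rw [this]
  refine Finset.measurableSet_biInter _ fun k _ => measurableSet_lt ?_ ?_
  · exact ((η.measurable_sum le_rfl).mono (ℱ.le k) le_rfl).comp measurable_snd
  · exact measurable_subtype_coe.comp measurable_fst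

/-- The mixed stopping time given by the random time of a randomized stopping time. -/
def toMixed : MixedStoppingTime ℱ where
  μ := η.time
  measurable := η.measurable_time
  isStoppingTime := η.isStoppingTime_time

/-- The partial sums of `ρ` are nondecreasing, so not stopping up to time `n` only asks that the
draw exceed the last of them; the interval above it has length `survival x (n + 1)`. -/
lemma realizes_time {x : ℕ → Ω → ℝ} (hx : ∀ n ω, ∑ i ∈ Finset.range n, η.ρ i ω = 1 - survival x n ω)
    (hx1 : ∀ n ω, survival x n ω ≤ 1) (hx0 : ∀ n ω, 0 ≤ survival x n ω) :
    Realizes (volume : Measure I) η.time x where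
  measurable := η.measurable_time
  measure_le ω n := by
    cases n with
    | zero => simp [survival]
    | succ n =>
      have h1 : {r : I | ((n + 1 : ℕ) : ℕ∞) ≤ η.time (r, ω)} =
          Set.Ioi ⟨1 - survival x (n + 1) ω, by linarith [hx1 (n + 1) ω],
            by linarith [hx0 (n + 1) ω]⟩ := by
        ext r
        simp only [natCast_le_time_iff, Set.mem_ofPred_eq, Set.mem_Ioi, ← Subtype.coe_lt_coe]
        rw [← hx]
        refine ⟨fun h => h n n.lt_succ_self, fun h k hk => lt_of_le_of_lt ?_ h⟩
        exact Finset.sum_le_sum_of_subset_of_nonneg (Finset.range_mono (by omega))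
          fun i _ _ => η.nonneg i ω
      rw [h1, unitInterval.volume_Ioi]
      simp

end RandomizedStoppingTime

namespace BehaviorStoppingTime

variable (η : BehaviorStoppingTime ℱ)

/-- The probability that a behavior stopping time equals `n`. -/
def mass (n : ℕ∞) (ω : Ω) : ℝ :=
  if n = ⊤ then ⨅ k, survival η.β k ω else survival η.β n.toNat ω * η.β n.toNat ω

lemma mass_natCast (n : ℕ) (ω : Ω) : η.mass n ω = survival η.β n ω * η.β n ω := by
  simp [mass]

lemma sum_mass (n : ℕ) (ω : Ω) : ∑ i ∈ Finset.range n, η.mass i ω = 1 - survival η.β n ω := by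
  induction n with
  | zero => simp [survival]
  | succ n ih =>
    rw [Finset.sum_range_succ, ih, mass_natCast, survival_succ]
    ring

lemma mass_nonneg (n : ℕ∞) (ω : Ω) : 0 ≤ η.mass n ω := by
  unfold mass
  split_ifs
  · exact le_ciInf fun k => η.survival_nonneg k ω
  · exact mul_nonneg (η.survival_nonneg _ ω) (η.mem_Icc _ ω).1

/-- The finite masses telescope to 1 minus the limit of the survival probabilities, and that limit
is the mass at `⊤`. -/
lemma hasSum_mass (ω : Ω) : HasSum (fun n => η.mass n ω) 1 := by
  have ht : Tendsto (fun n => survival η.β n ω) atTop (𝓝 (η.mass ⊤ ω)) := by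
    have : η.mass ⊤ ω = ⨅ k, survival η.β k ω := by simp [mass]
    rw [this]
    exact tendsto_atTop_ciInf (antitone_nat_of_succ_le fun n => η.survival_succ_le n ω)
      ⟨0, by rintro _ ⟨n, rfl⟩; exact η.survival_nonneg n ω⟩
  have h1 : HasSum (fun n : ℕ => η.mass n ω) (1 - η.mass ⊤ ω) := by
    rw [hasSum_iff_tendsto_nat_of_nonneg fun n => η.mass_nonneg n ω]
    simp_rw [sum_mass]
    exact ht.const_sub 1
  have h2 : HasSum (fun n : ℕ∞ => if n = ⊤ then 0 else η.mass n ω) (1 - η.mass ⊤ ω) := by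
    rw [← Function.Injective.hasSum_iff (g := ((↑) : ℕ → ℕ∞)) Nat.cast_injective]
    · exact h1.congr_fun fun n => by simp
    · intro n hn
      have : n = ⊤ := by
        by_contra hne
        obtain ⟨k, hk⟩ := ENat.ne_top_iff_exists.1 hne
        exact hn ⟨k, hk⟩
      simp [this]
  have h3 := h2.add (hasSum_ite_eq (⊤ : ℕ∞) (η.mass ⊤ ω))
  rw [sub_add_cancel] at h3
  refine h3.congr_fun fun n => ?_
  by_cases hn : n = ⊤ <;> simp [hn]

/-- The randomized stopping time with the same conditional law as a behavior stopping time. -/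
def toRandomized : RandomizedStoppingTime ℱ where
  ρ := η.mass
  adapted := by
    constructor
    · intro n
      have : η.mass n = fun ω => survival η.β n ω * η.β n ω := by
        ext ω
        exact η.mass_natCast n ω
      rw [this]
      exact (η.measurable_survival n.le_succ).mul (η.adapted n)
    · have : η.mass ⊤ = fun ω => ⨅ k, survival η.β k ω := by
        ext ω
        simp [mass]
      rw [this]
      exact Measurable.iInf fun n => (η.measurable_survival n.le_succ).mono (le_iSup _ n) le_rfl
  nonneg := η.mass_nonneg
  hasSum := η.hasSum_mass

lemma realizes_time_toRandomized : Realizes (volume : Measure I) η.toRandomized.time η.β :=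
  η.toRandomized.realizes_time η.sum_mass η.survival_le_one η.survival_nonneg

end BehaviorStoppingTime

/-! The value of the game -/

/-- It suffices that each player secures `v` up to every positive error; optimal strategies need not
exist. -/
lemma isValue_of_guarantee {S T : Type*} {γ : S → T → ℝ} {v : ℝ}
    (hmax : ∀ e > 0, ∃ s, ∀ t, v - e ≤ γ s t) (hmin : ∀ e > 0, ∃ t, ∀ s, γ s t ≤ v + e) :
    IsValue γ v := by
  have hle : (⨆ s, ⨅ t, (γ s t : EReal)) ≤ ⨅ t, ⨆ s, (γ s t : EReal) :=
    iSup_iInf_le_iInf_iSup _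
  have hlow : (v : EReal) ≤ ⨆ s, ⨅ t, (γ s t : EReal) := by
    refine le_of_forall_lt_imp_le_of_dense fun c hc => ?_
    obtain ⟨q, hcq, hqv⟩ := EReal.lt_iff_exists_real_btwn.1 hc
    obtain ⟨s, hs⟩ := hmax (v - q) (sub_pos.2 (by exact_mod_cast hqv))
    refine hcq.le.trans (le_iSup_of_le s (le_iInf fun t => ?_))
    exact_mod_cast (by linarith [hs t] : q ≤ γ s t)
  have hup : (⨅ t, ⨆ s, (γ s t : EReal)) ≤ v := by
    refine le_of_forall_gt_imp_ge_of_dense fun c hc => ?_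
    obtain ⟨q, hvq, hqc⟩ := EReal.lt_iff_exists_real_btwn.1 hc
    obtain ⟨t, ht⟩ := hmin (q - v) (sub_pos.2 (by exact_mod_cast hvq))
    refine le_trans (iInf_le_of_le t (iSup_le fun s => ?_)) hqc.le
    exact_mod_cast (by linarith [ht s] : γ s t ≤ q)
  exact ⟨le_antisymm (hle.trans hup) hlow, le_antisymm hup (hlow.trans hle)⟩

namespace StoppingGame

variable (G : StoppingGame (Fin 2) P ℱ)

/-- Payoff of the first player when exactly the players in `C` stop. -/
def maxPayoff (C : Coalition (Fin 2)) (n : ℕ∞) (ω : Ω) : ℝ := G.X n ω (0, C)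

/-- Equal times make everyone a stopper, including when both are `⊤`; this is why one process `C`
covers simultaneous stopping and never stopping. -/
lemma realizedPayoff_eq_pay (s t : ℕ∞) (ω : Ω) :
    G.realizedPayoff 0 ![s, t] ω = pay (G.maxPayoff ⟨{0}, by simp⟩) (G.maxPayoff ⟨{1}, by simp⟩)
      (G.maxPayoff ⟨Finset.univ, by simp⟩) s t ω := by
  have hinf : ⨅ i, ![s, t] i = min s t := by
    refine le_antisymm (le_min (iInf_le _ 0) (iInf_le _ 1)) (le_iInf fun i => ?_)
    fin_cases i
    exacts [min_le_left _ _, min_le_right _ _]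
  have hst (D : Coalition (Fin 2)) (hD : ∀ i, ![s, t] i = min s t ↔ i ∈ D.1) :
      stoppers ![s, t] = D := by
    refine Subtype.ext (Finset.ext fun i => ?_)
    simp [stoppers, hinf, ← hD i]
  unfold realizedPayoff pay
  rw [hinf]
  rcases lt_trichotomy s t with h | rfl | h
  · rw [if_pos h, min_eq_left h.le, hst ⟨{0}, by simp⟩]
    · rfl
    · intro i
      fin_cases i <;> simp [h.le, h.ne']
  · rw [if_neg (lt_irrefl _), if_neg (lt_irrefl _), min_self, hst ⟨Finset.univ, by simp⟩]
    · rfl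
    · intro i
      fin_cases i <;> simp
  · rw [if_neg h.not_gt, if_pos h, min_eq_right h.le, hst ⟨{1}, by simp⟩]
    · rfl
    · intro i
      fin_cases i <;> simp [h.le, h.ne']

lemma payoffProcesses (hℱ : ⨆ n, ℱ n = mΩ) (C₁ C₂ C₃ : Coalition (Fin 2)) :
    PayoffProcesses P ℱ (G.maxPayoff C₁) (G.maxPayoff C₂) (G.maxPayoff C₃)
      (fun ω => (⨆ n : ℕ∞, ‖G.X n ω‖ₑ).toReal) := by
  have had (C : Coalition (Fin 2)) (n : ℕ) : Measurable[ℱ n] (G.maxPayoff C n) :=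
    (measurable_pi_apply (0, C)).comp (G.adapted.1 n)
  have htop : Measurable (G.X ⊤) := G.adapted.2.mono hℱ.le le_rfl
  have htop' (C : Coalition (Fin 2)) : Measurable (G.maxPayoff C ⊤) :=
    (measurable_pi_apply (0, C)).comp htop
  have hX (n : ℕ∞) : Measurable (G.X n) := by
    induction n with
    | top => exact htop
    | coe n => exact (G.adapted.1 n).mono (ℱ.le n) le_rfl
  have hm : Measurable fun ω => ⨆ n : ℕ∞, ‖G.X n ω‖ₑ := Measurable.iSup fun n => (hX n).enorm
  refine ⟨had C₁, had C₂, had C₃, htop' C₁, htop' C₂, htop' C₃,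
    integrable_toReal_of_lintegral_ne_top hm.aemeasurable G.integrable.ne, ?_⟩
  -- Where the supremum is infinite `toReal` returns 0, so the bound is available only almost
  -- everywhere.
  filter_upwards [ae_lt_top hm G.integrable.ne] with ω hω n
  have key (C : Coalition (Fin 2)) : |G.maxPayoff C n ω| ≤ (⨆ n : ℕ∞, ‖G.X n ω‖ₑ).toReal := by
    refine (norm_le_pi_norm (G.X n ω) (0, C)).trans ?_
    rw [← toReal_enorm]
    exact ENNReal.toReal_mono hω.ne (le_iSup (fun n : ℕ∞ => ‖G.X n ω‖ₑ) n)
  exact ⟨key C₁, key C₂, key C₃⟩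

/-- The limit of the values of the truncated games is the value of the game in each class of random
stopping times that realizes all behavior stopping times. -/
theorem isValue_expectedPayoff [IsProbabilityMeasure P] (hℱ : ⨆ n, ℱ n = mΩ)
    [IsProbabilityMeasure Q] {S : Type*} {N : S → R × Ω → ℕ∞} (hN : ∀ s, Measurable (N s))
    (hN' : ∀ s r, IsStoppingTime ℱ fun ω => N s (r, ω))
    (hreal : ∀ η : BehaviorStoppingTime ℱ, ∃ s, Realizes Q (N s) η.β) :
    IsValue (fun s t => G.expectedPayoff 0 Q (N s) (N t))
      (∫ ω, limitValue P ℱ (G.maxPayoff ⟨{0}, by simp⟩) (G.maxPayoff ⟨{1}, by simp⟩)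
        (G.maxPayoff ⟨Finset.univ, by simp⟩) 0 ω ∂P) := by
  have h := G.payoffProcesses hℱ ⟨{0}, by simp⟩ ⟨{1}, by simp⟩ ⟨Finset.univ, by simp⟩
  set A := G.maxPayoff ⟨{0}, by simp⟩
  set B := G.maxPayoff ⟨{1}, by simp⟩
  set C := G.maxPayoff ⟨Finset.univ, by simp⟩
  set v := ∫ ω, limitValue P ℱ A B C 0 ω ∂P
  have hpay (s t : S) : G.expectedPayoff 0 Q (N s) (N t) =
      ∫ z : R × R × Ω, pay A B C (N s (z.1, z.2.2)) (N t z.2) z.2.2 ∂(Q.prod (Q.prod P)) := by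
    unfold expectedPayoff
    exact integral_congr_ae (Eventually.of_forall fun z => G.realizedPayoff_eq_pay _ _ _)
  have hint (s t : S) : Integrable (fun z : R × R × Ω => pay A B C (N s (z.1, z.2.2))
      (N t z.2) z.2.2) (Q.prod (Q.prod P)) := by
    refine ((h.integrable.comp_snd Q).comp_snd Q).mono' (h.measurable_pay
      ((hN s).comp (by fun_prop)) ((hN t).comp (by fun_prop)) (by fun_prop)).aestronglyMeasurable ?_
    filter_upwards [Measure.quasiMeasurePreserving_snd.ae (h.ae_bound Q)] with z hz
    exact PayoffProcesses.abs_pay_le (A := A) (B := B) (C := C)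
      (H := fun ω => (⨆ n : ℕ∞, ‖G.X n ω‖ₑ).toReal) hz _ _
  have hτ (t : S) (r : R) : Measurable fun ω => N t (r, ω) := (hN t).comp measurable_prodMk_left
  refine isValue_of_guarantee (fun e he => ?_) (fun e he => ?_)
  · obtain ⟨η, hη⟩ := h.exists_maximizer_guarantee hℱ he
    obtain ⟨s, hs⟩ := hreal η
    refine ⟨s, fun t => ?_⟩
    have hsec : Integrable (fun y : R × Ω => ∫ x, pay A B C (N s (x, y.2)) (N t y) y.2 ∂Q)
        (Q.prod P) := (hint s t).integral_prod_right
    -- Once the opponent's draw `r` is fixed he uses a pure stopping time, to which the guarantee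
    -- applies; independence of the draws allows integration over `r`.
    have hr (r : R) : v - e ≤ ∫ ω, ∫ x, pay A B C (N s (x, ω)) (N t (r, ω)) ω ∂Q ∂P := by
      have h1 := hη _ (hN' t r)
      rw [h.integral_pay_congr η.realizes_time hs (hτ t r), integral_prod_symm _
        (h.integrable_pay (t := fun z => N t (r, z.2)) (hN s) ((hτ t r).comp measurable_snd))] at h1
      exact h1
    rw [hpay, integral_prod_symm _ (hint s t), integral_prod _ hsec]
    calc v - e = ∫ _, (v - e) ∂Q := by simp
      _ ≤ _ := integral_mono (integrable_const _) hsec.integral_prod_left hr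
  · have ht := (h.tendsto_integral_truncValue 0).eventually
      (gt_mem_nhds (show v < v + e by linarith))
    obtain ⟨T, hT⟩ := ht.exists
    obtain ⟨t, ht⟩ := hreal (h.truncStrategy T)
    refine ⟨t, fun s => ?_⟩
    rw [hpay, integral_prod _ (hint s t)]
    have hr (r : R) : ∫ z : R × Ω, pay A B C (N s (r, z.2)) (N t z) z.2 ∂(Q.prod P) ≤ v + e :=
      (h.integral_pay_truncStrategy_le T ht (hN' s r)).trans hT.le
    calc _ ≤ ∫ _, (v + e) ∂Q :=
          integral_mono (hint s t).integral_prod_left (integrable_const _) hr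
      _ = v + e := by simp

end StoppingGame

end

end

end StoppingGames

theorem mainTheorem6 {Ω : Type*} {mΩ : MeasurableSpace Ω} (P : Measure Ω) [IsProbabilityMeasure P]
    (ℱ : Filtration ℕ mΩ) (hℱ : ⨆ n, ℱ n = mΩ)
    (G : StoppingGames.StoppingGame (Fin 2) P ℱ) (hG : G.IsZeroSum) :
    ∃ v : ℝ,
      StoppingGames.IsValue (fun η₁ η₂ => G.payoffRandomized 0 η₁ η₂) v ∧
      StoppingGames.IsValue (fun η₁ η₂ => G.payoffBehavior 0 η₁ η₂) v ∧
      StoppingGames.IsValue (fun η₁ η₂ => G.payoffMixed 0 η₁ η₂) v := by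
  -- The integral of `limitValue` at time 0 involves no class of random times, so one number serves
  -- all three. Mixed stopping times realize behavior ones through randomized ones, whose time at a
  -- fixed draw is a stopping time.
  exact ⟨_,
    G.isValue_expectedPayoff hℱ (fun η => η.measurable_time) (fun η => η.isStoppingTime_time)
      (fun η => ⟨η.toRandomized, η.realizes_time_toRandomized⟩),
    G.isValue_expectedPayoff hℱ (fun η => η.realizes_time.measurable)
      (fun η => η.isStoppingTime_time) (fun η => ⟨η, η.realizes_time⟩),
    G.isValue_expectedPayoff hℱ (fun η => η.measurable) (fun η => η.isStoppingTime)
      (fun η => ⟨η.toRandomized.toMixed, η.realizes_time_toRandomized⟩)⟩
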